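/- Let $p_0=(0,0)$, $p_1=(\tfrac12,0)$, $p_2=(1,0)$, $p_3=(1,\tfrac12)$, $p_4=(1,1)$, $p_5=(\tfrac12,1)$, $p_6=(0,1)$, $p_7=(0,\tfrac12)$ in $\mathbb{R}^2$ and $f_i(x)=(x+2p_i)/3$ for $i=0,\dots,7$. The Sierpiński carpet $K$ is the unique non-empty compact set in $\mathbb{R}^2$ with $K=\bigcup_{i=0}^7 f_i(K)$. Let $\alpha=\log 8/\log 3$ be its Hausdorff dimension and $\nu$ the normalized $\alpha$-dimensional Hausdorff measure on $K$ (with the Euclidean metric). For $\beta>0$ let $$\mathcal{E}_\beta(u,u)=\int_K\int_K\frac{(u(x)-u(y))^2}{|x-y|^{\alpha+\beta}}\,\nu(\mathrm{d}x)\,\nu(\mathrm{d}y),\qquad \mathcal{F}_\beta=\{u\in L^2(K;\nu):\mathcal{E}_\beta(u,u)<+\infty\},$$ and extend $\mathcal{E}_\beta$ to a bilinear form on $\mathcal{F}_\beta$ by polarization. The walk dimension of the Sierpiński carpet is $$\beta_*:=\sup\{\beta>0:(\mathcal{E}_\beta,\mathcal{F}_\beta)\text{ is a regular Dirichlet form on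 }L^2(K;\nu)\}.$$ Here a Dirichlet form is a densely defined, symmetric, non-negative definite bilinear form $(\mathcal{E},\mathcal{F})$ on $L^2(K;\nu)$ that is closed (that is, $\mathcal{F}$ is complete for the inner product $\mathcal{E}_1(u,v)=\mathcal{E}(u,v)+(u,v)_{L^2}$) and Markovian (that is, for every $\varepsilon>0$ there is $\varphi_\varepsilon:\mathbb{R}\to[-\varepsilon,1+\varepsilon]$ with $\varphi_\varepsilon(t)=t$ on $[0,1]$ and $0\le\varphi_\varepsilon(t)-\varphi_\varepsilon(s)\le t-s$ for $s\le t$, such that $\varphi_\varepsilon(u)\in\mathcal{F}$ and $\mathcal{E}(\varphi_\varepsilon(u),\varphi_\varepsilon(u))\le\mathcal{E}(u,u)$ for all $u\in\mathcal{F}$); it is regular if $\mathcal{F}\cap C(K)$ is dense in $\mathcal{F}$ for the norm of $\mathcal{E}_1$ and uniformly dense in $C(K)$. Theorem. The set in the definition of $\beta_*$ is non-empty and bounded above, and $$\beta_*\in\left[\frac{\log\left(8\cdot\frac{7}{6}\right)}{\log 3},\ \frac{\log\left(8\cdot\frac{3}{2}\right)}{\log 3}\right].$$ -/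

import Mathlib

open MeasureTheory Filter Topology

/-! ### Dirichlet forms

A form is given by a map `E` together with a domain `D`; only the values of `E` on `D` matter. -/

/-- `(E, D)` is a symmetric form on the real Hilbert space `H`: `D` is a dense linear subspace of `H`
and `E` is a symmetric nonnegative definite bilinear form on `D`. -/
structure IsSymmetricForm {H : Type*} [NormedAddCommGroup H] [InnerProductSpace ℝ H]
    (E : H → H → ℝ) (D : Set H) : Prop where
  zero_mem : (0 : H) ∈ D
  add_mem : ∀ u ∈ D, ∀ v ∈ D, u + v ∈ D
  smul_mem : ∀ (c : ℝ), ∀ u ∈ D, c • u ∈ D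
  dense : Dense D
  symm : ∀ u ∈ D, ∀ v ∈ D, E u v = E v u
  add_left : ∀ u ∈ D, ∀ u' ∈ D, ∀ v ∈ D, E (u + u') v = E u v + E u' v
  smul_left : ∀ (c : ℝ), ∀ u ∈ D, ∀ v ∈ D, E (c • u) v = c * E u v
  nonneg : ∀ u ∈ D, 0 ≤ E u u

/-- The form `E₁(u, v) = E(u, v) + (u, v)`. -/
noncomputable def formOne {H : Type*} [NormedAddCommGroup H] [InnerProductSpace ℝ H]
    (E : H → H → ℝ) (u v : H) : ℝ :=
  E u v + inner ℝ u v

/-- A symmetric form is closed if `(D, E₁)` is a Hilbert space, i.e. if every sequence in `D` that is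
Cauchy for the norm of `E₁` converges in this norm to an element of `D`. -/
structure IsClosedForm {H : Type*} [NormedAddCommGroup H] [InnerProductSpace ℝ H]
    (E : H → H → ℝ) (D : Set H) : Prop extends IsSymmetricForm E D where
  complete : ∀ u : ℕ → H, (∀ n, u n ∈ D) →
    (∀ ε : ℝ, 0 < ε → ∃ N : ℕ, ∀ m ≥ N, ∀ n ≥ N, formOne E (u m - u n) (u m - u n) < ε) →
    ∃ v ∈ D, Tendsto (fun n => formOne E (u n - v) (u n - v)) atTop (𝓝 0)

/-- The Markovian property of a form on `L²(X; m)`. -/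
def IsMarkovian {X : Type*} [MeasurableSpace X] {m : Measure X}
    (E : Lp ℝ 2 m → Lp ℝ 2 m → ℝ) (D : Set (Lp ℝ 2 m)) : Prop :=
  ∀ ε : ℝ, 0 < ε → ∃ φ : ℝ → ℝ,
    (∀ t ∈ Set.Icc (0 : ℝ) 1, φ t = t) ∧
    (∀ t, φ t ∈ Set.Icc (-ε) (1 + ε)) ∧
    (∀ s t, s ≤ t → 0 ≤ φ t - φ s ∧ φ t - φ s ≤ t - s) ∧
    ∀ u ∈ D, ∃ v ∈ D, (⇑v =ᵐ[m] fun x => φ (u x)) ∧ E v v ≤ E u u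

/-- A Dirichlet form on `L²(X; m)` is a Markovian closed symmetric form. -/
structure IsDirichletForm {X : Type*} [MeasurableSpace X] {m : Measure X}
    (E : Lp ℝ 2 m → Lp ℝ 2 m → ℝ) (D : Set (Lp ℝ 2 m)) : Prop extends IsClosedForm E D where
  markovian : IsMarkovian E D

/-- The Dirichlet form `(E, D)` on `L²(X; m)` is regular: `D ∩ C_c(X)` is `E₁`-dense in `D` and
uniformly dense in `C_c(X)`. An element `v` of `L²(X; m)` is in `C_c(X)` if it has a continuous
representative `f` with compact support. -/
structure IsRegularDirichletForm {X : Type*} [TopologicalSpace X] [MeasurableSpace X] {m : Measure X}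
    (E : Lp ℝ 2 m → Lp ℝ 2 m → ℝ) (D : Set (Lp ℝ 2 m)) : Prop extends IsDirichletForm E D where
  dense_domain : ∀ u ∈ D, ∀ ε : ℝ, 0 < ε →
    ∃ v ∈ D, (∃ f : X → ℝ, Continuous f ∧ HasCompactSupport f ∧ ⇑v =ᵐ[m] f) ∧
      formOne E (u - v) (u - v) < ε
  dense_continuous : ∀ g : X → ℝ, Continuous g → HasCompactSupport g → ∀ ε : ℝ, 0 < ε →
    ∃ v ∈ D, ∃ f : X → ℝ, Continuous f ∧ HasCompactSupport f ∧ ⇑v =ᵐ[m] f ∧ ∀ x, |g x - f x| < ε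

/-! ### The Sierpiński carpet -/

namespace SierpinskiCarpet

/-- The Euclidean plane. -/
abbrev Plane : Type := EuclideanSpace ℝ (Fin 2)

/-- The corners and the midpoints of the sides of the unit square. -/
noncomputable def vertex : Fin 8 → Plane :=
  ![!₂[0, 0], !₂[1 / 2, 0], !₂[1, 0], !₂[1, 1 / 2], !₂[1, 1], !₂[1 / 2, 1], !₂[0, 1], !₂[0, 1 / 2]]

/-- The similitudes `f_i(x) = (x + 2 p_i) / 3`. -/
noncomputable def contraction (i : Fin 8) (x : Plane) : Plane :=
  (1 / 3 : ℝ) • (x + (2 : ℝ) • vertex i)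

/-- The map `A ↦ ⋃ i, f_i(A)` on sets. -/
def step (A : Set Plane) : Set Plane := ⋃ i, contraction i '' A

/-- The unit square `[0, 1]²`. -/
def unitSquare : Set Plane := {x | ∀ j, x j ∈ Set.Icc (0 : ℝ) 1}

/-- The Sierpiński carpet: what remains of the unit square when the subdivision into nine squares and
removal of the central one is repeated infinitely often. By `eq_carpet_iff` below it is the unique
nonempty compact set `K` with `K = ⋃ i, f_i(K)`. -/
def carpet : Set Plane := ⋂ n : ℕ, step^[n] unitSquare

lemma vertex_mem (i : Fin 8) (j : Fin 2) : vertex i j ∈ Set.Icc (0 : ℝ) 1 := by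
  fin_cases i <;> fin_cases j <;> norm_num [vertex]

lemma continuous_contraction (i : Fin 8) : Continuous (contraction i) := by
  unfold contraction; fun_prop

lemma dist_contraction (i : Fin 8) (x y : Plane) :
    dist (contraction i x) (contraction i y) = (1 / 3) * dist x y := by
  simp [contraction, dist_smul₀]

lemma contraction_injective (i : Fin 8) : Function.Injective (contraction i) := by
  intro x y h
  have := dist_contraction i x y
  rw [h, dist_self] at this
  exact dist_eq_zero.1 (by linarith)

lemma step_mono : Monotone step := fun _ _ h =>
  Set.iUnion_mono fun _ => Set.image_mono h

lemma isCompact_unitSquare : IsCompact unitSquare := by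
  have h : unitSquare = (EuclideanSpace.equiv (Fin 2) ℝ).toHomeomorph ⁻¹'
      (Set.univ.pi fun _ => Set.Icc (0 : ℝ) 1) := by
    ext x
    simp only [unitSquare, Set.mem_ofPred_eq, Set.mem_preimage, Set.mem_univ_pi]
    rfl
  rw [h]
  exact (Homeomorph.isCompact_preimage _).2 (isCompact_univ_pi fun _ => isCompact_Icc)

lemma step_unitSquare_subset : step unitSquare ⊆ unitSquare := by
  rintro _ ⟨_, ⟨i, rfl⟩, x, hx, rfl⟩ j
  have h1 := hx j
  have h2 := vertex_mem i j
  simp only [Set.mem_Icc] at h1 h2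
  simp only [contraction, PiLp.smul_apply, PiLp.add_apply, smul_eq_mul, Set.mem_Icc]
  constructor <;> linarith [h1.1, h1.2, h2.1, h2.2]

lemma isCompact_step {A : Set Plane} (hA : IsCompact A) : IsCompact (step A) :=
  isCompact_iUnion fun i => hA.image (continuous_contraction i)

lemma isCompact_iterate (n : ℕ) : IsCompact (step^[n] unitSquare) := by
  induction n with
  | zero => exact isCompact_unitSquare
  | succ n ih => rw [Function.iterate_succ_apply']; exact isCompact_step ih

lemma iterate_succ_subset (n : ℕ) : step^[n + 1] unitSquare ⊆ step^[n] unitSquare := by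
  rw [Function.iterate_succ_apply]
  exact step_mono.iterate n step_unitSquare_subset

lemma zero_mem_carpet : (0 : Plane) ∈ carpet := by
  refine Set.mem_iInter.2 fun n => ?_
  induction n with
  | zero => intro j; simp
  | succ n ih =>
    rw [Function.iterate_succ_apply']
    refine Set.mem_iUnion.2 ⟨0, 0, ih, ?_⟩
    ext j
    fin_cases j <;> simp [contraction, vertex]

lemma isCompact_carpet : IsCompact carpet :=
  isCompact_unitSquare.of_isClosed_subset
    (isClosed_iInter fun n => (isCompact_iterate n).isClosed) (Set.iInter_subset _ 0)

lemma step_carpet : step carpet = carpet := by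
  have hanti : Antitone fun n => step^[n] unitSquare := antitone_nat_of_succ_le iterate_succ_subset
  apply Set.Subset.antisymm
  · refine Set.subset_iInter fun n => ?_
    refine Set.Subset.trans ?_ (iterate_succ_subset n)
    rw [Function.iterate_succ_apply']
    exact step_mono (Set.iInter_subset _ n)
  · intro x hx
    have hx' : ∀ n, ∃ i, x ∈ contraction i '' (step^[n] unitSquare) := fun n => by
      have := Set.mem_iInter.1 hx (n + 1)
      rw [Function.iterate_succ_apply'] at this
      exact Set.mem_iUnion.1 this
    choose i hi using hx'
    obtain ⟨k, hk⟩ := Finite.exists_infinite_fiber i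
    have hk' : (i ⁻¹' {k}).Infinite := Set.infinite_coe_iff.1 hk
    have key : ∀ n, x ∈ contraction k '' (step^[n] unitSquare) := fun n => by
      obtain ⟨m, hm, hnm⟩ := hk'.exists_gt n
      have h := hi m
      rw [show i m = k from hm] at h
      exact Set.image_mono (hanti hnm.le) h
    refine Set.mem_iUnion.2 ⟨k, ?_⟩
    rw [carpet, (contraction_injective k).injOn.image_iInter_eq]
    exact Set.mem_iInter.2 key

lemma subset_of_step_eq {A B : Set Plane} (hA : IsCompact A) (hB : IsClosed B)
    (hBne : B.Nonempty) (hAs : step A = A) (hBs : step B = B) : A ⊆ B := by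
  intro x hx
  obtain ⟨z, hz, hmax⟩ := hA.exists_isMaxOn ⟨x, hx⟩
    (Metric.continuous_infDist_pt B).continuousOn
  have hz' := hz
  rw [← hAs] at hz'
  obtain ⟨i, a, ha, rfl⟩ := Set.mem_iUnion.1 hz'
  have h1 : Metric.infDist (contraction i a) B ≤ (1 / 3) * Metric.infDist a B := by
    refine le_of_forall_pos_le_add fun ε hε => ?_
    obtain ⟨b, hb, hlt⟩ := (Metric.infDist_lt_iff hBne).1
      (lt_add_of_pos_right (Metric.infDist a B) hε)
    have hb' : contraction i b ∈ B := by
      rw [← hBs]; exact Set.mem_iUnion.2 ⟨i, b, hb, rfl⟩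
    have := Metric.infDist_le_dist_of_mem (x := contraction i a) hb'
    rw [dist_contraction] at this
    linarith
  have h2 : Metric.infDist a B ≤ Metric.infDist (contraction i a) B := hmax ha
  have h3 : Metric.infDist x B ≤ Metric.infDist (contraction i a) B := hmax hx
  have h4 : 0 ≤ Metric.infDist x B := Metric.infDist_nonneg
  have h5 : 0 ≤ Metric.infDist a B := Metric.infDist_nonneg
  exact (hB.mem_iff_infDist_zero hBne).2 (by linarith)

/-- The carpet is the unique nonempty compact set `K` with `K = ⋃ i, f_i(K)`. -/
lemma eq_carpet_iff (K : Set Plane) :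
    K = carpet ↔ K.Nonempty ∧ IsCompact K ∧ K = ⋃ i, contraction i '' K := by
  constructor
  · rintro rfl
    exact ⟨⟨0, zero_mem_carpet⟩, isCompact_carpet, step_carpet.symm⟩
  · rintro ⟨hne, hc, hs⟩
    exact Set.Subset.antisymm
      (subset_of_step_eq hc isCompact_carpet.isClosed ⟨0, zero_mem_carpet⟩ hs.symm step_carpet)
      (subset_of_step_eq isCompact_carpet hc.isClosed hne step_carpet hs.symm)

/-- The Hausdorff dimension `α = log 8 / log 3` of the carpet. -/
noncomputable def hausdorffDim : ℝ := Real.log 8 / Real.log 3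

/-- The normalized `α`-dimensional Hausdorff measure on the carpet (with its Euclidean metric). -/
noncomputable def hausdorffProb : Measure carpet :=
  ((Measure.hausdorffMeasure hausdorffDim : Measure carpet) Set.univ)⁻¹ •
    (Measure.hausdorffMeasure hausdorffDim : Measure carpet)

/-- The value in `[0, ∞]` of the quadratic form
`𝓔_β(u, u) = ∫_K ∫_K (u(x) - u(y))² / |x - y|^(α + β) ν(dx) ν(dy)`. -/
noncomputable def energy (β : ℝ) (u : Lp ℝ 2 hausdorffProb) : ENNReal :=
  ∫⁻ x, ∫⁻ y, ENNReal.ofReal ((u x - u y) ^ 2 / dist x y ^ (hausdorffDim + β))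
    ∂hausdorffProb ∂hausdorffProb

/-- The domain `𝓕_β = {u ∈ L²(K; ν) : 𝓔_β(u, u) < ∞}`. -/
def domain (β : ℝ) : Set (Lp ℝ 2 hausdorffProb) := {u | energy β u < ⊤}

/-- The bilinear form on `𝓕_β` obtained from the quadratic form by polarization,
`𝓔_β(u, v) = ∫_K ∫_K (u(x) - u(y)) (v(x) - v(y)) / |x - y|^(α + β) ν(dx) ν(dy)`. -/
noncomputable def form (β : ℝ) (u v : Lp ℝ 2 hausdorffProb) : ℝ :=
  ∫ x, ∫ y, (u x - u y) * (v x - v y) / dist x y ^ (hausdorffDim + β)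
    ∂hausdorffProb ∂hausdorffProb

/-- The set of all `β > 0` such that `(𝓔_β, 𝓕_β)` is a regular Dirichlet form on `L²(K; ν)`. -/
def regularIndices : Set ℝ := {β | 0 < β ∧ IsRegularDirichletForm (form β) (domain β)}

/-- The walk dimension `β_*` of the carpet. -/
noncomputable def walkDim : ℝ := sSup regularIndices

end SierpinskiCarpet

namespace SierpinskiCarpet

/-! ### Self-similar probability measures on the carpet -/

/-! Everything rests on the self-similarity of `ν = hausdorffProb`, i.e. `8 ν(A) = ∑ ν(f_i⁻¹ A)`. It
makes balls of radius about `3⁻ⁿ` have mass of order `8⁻ⁿ`, so a pair of sets of that size and at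
that distance is seen by the energy with factor `8²ⁿ · 3^(-n(α+β)) = (8 / 3^β)ⁿ`.

Upper bound. The rows whose triadic digits are all `0` or `2` miss every hole, so at level `n` there
are `2ⁿ` unbroken rows of `3ⁿ` squares. If `u` is close to the first coordinate, its averages rise
by a fixed amount along each row, and Cauchy–Schwarz bounds the sum of squared increments per row
below by `c 3⁻ⁿ`. Finite energy bounds the sum over all rows by `C (8 / 3^β)ⁿ`. Hence `(2/3)ⁿ ≤ C'
(8 / 3^β)ⁿ` for all large `n`, which forces `3^β ≤ 12` (`three_rpow_le_of_approx`).

Lower bound. For `α < β` with `3^β < 28/3` the form is regular. It is closed because it is the graph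
form of a closed difference quotient operator, and Markovian because truncation shrinks differences.
For `β > α` every function in the domain is continuous (`exists_continuous_ae_eq`), so only uniform
density remains. Continuous functions of finite energy form an algebra, and by Stone–Weierstrass it
suffices to separate points. This is done by `F(x_j)`, with `F` the distribution function of the
self-similar measure on `[0,1]` with weights `2/7, 3/7, 2/7`. The columns of the carpet contain `3,
2, 3` cells, and these weights minimise `3a² + 2b² + 3c²` subject to `a + b + c = 1`, with minimum
`6/7`. Level `n` then contributes a multiple of `(3^β · (6/7) / 8)ⁿ` to the bound on the energy
(`funEnergy_coordCdf_lt_top`). -/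

instance : CompactSpace carpet := isCompact_iff_compactSpace.1 isCompact_carpet

/-- The similitude `f_i` as a map of the carpet into itself. -/
noncomputable def cellMap (i : Fin 8) (x : carpet) : carpet :=
  ⟨contraction i x, step_carpet.subset (Set.mem_iUnion.2 ⟨i, x, x.2, rfl⟩)⟩

/-- The coordinates of the point `2 p_i`. -/
def digit : Fin 8 → Fin 2 → ℕ :=
  ![![0, 0], ![1, 0], ![2, 0], ![2, 1], ![2, 2], ![1, 2], ![0, 2], ![0, 1]]

lemma digit_injective : Function.Injective digit := by decide

lemma digit_le (i : Fin 8) (j : Fin 2) : digit i j ≤ 2 := by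
  fin_cases i <;> fin_cases j <;> simp [digit]

lemma cellMap_apply (i : Fin 8) (x : carpet) (j : Fin 2) :
    (cellMap i x).1 j = (x.1 j + digit i j) / 3 := by
  have h : 2 * vertex i j = digit i j := by
    fin_cases i <;> fin_cases j <;> norm_num [vertex, digit]
  simp only [cellMap, contraction, PiLp.smul_apply, PiLp.add_apply, smul_eq_mul, h]
  ring

lemma dist_cellMap (i : Fin 8) (x y : carpet) :
    dist (cellMap i x) (cellMap i y) = (1 / 3) * dist x y :=
  dist_contraction i x y

lemma continuous_cellMap (i : Fin 8) : Continuous (cellMap i) :=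
  ((continuous_contraction i).comp continuous_subtype_val).subtype_mk _

lemma measurable_cellMap (i : Fin 8) : Measurable (cellMap i) := (continuous_cellMap i).measurable

lemma exists_cellMap_eq (x : carpet) : ∃ i y, cellMap i y = x := by
  obtain ⟨i, y, hy, hxy⟩ := Set.mem_iUnion.1 (step_carpet.symm.subset x.2)
  exact ⟨i, ⟨y, hy⟩, Subtype.ext hxy⟩

lemma coord_mem (x : carpet) (j : Fin 2) : x.1 j ∈ Set.Icc (0 : ℝ) 1 :=
  Set.mem_iInter.1 x.2 0 j

lemma continuous_coord (j : Fin 2) : Continuous fun x : carpet => x.1 j := by fun_prop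

lemma measurable_coord (j : Fin 2) : Measurable fun x : carpet => x.1 j :=
  (continuous_coord j).measurable

lemma abs_coord_sub_le (x y : carpet) (j : Fin 2) : |x.1 j - y.1 j| ≤ dist x y := by
  have := PiLp.norm_apply_le (x.1 - y.1) j
  rwa [← dist_eq_norm, PiLp.sub_apply, Real.norm_eq_abs] at this

lemma dist_le_add (x y : carpet) : dist x y ≤ |x.1 0 - y.1 0| + |x.1 1 - y.1 1| := by
  rw [Subtype.dist_eq, EuclideanSpace.dist_eq, Fin.sum_univ_two, Real.dist_eq, Real.dist_eq]
  refine Real.sqrt_le_iff.2 ⟨by positivity, ?_⟩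
  nlinarith [mul_nonneg (abs_nonneg (x.1 0 - y.1 0)) (abs_nonneg (x.1 1 - y.1 1))]

lemma dist_le_two (x y : carpet) : dist x y ≤ 2 := by
  have h0 := coord_mem x 0
  have h1 := coord_mem x 1
  have h2 := coord_mem y 0
  have h3 := coord_mem y 1
  have : |x.1 0 - y.1 0| ≤ 1 := abs_le.2 ⟨by linarith [h0.1, h2.2], by linarith [h0.2, h2.1]⟩
  have : |x.1 1 - y.1 1| ≤ 1 := abs_le.2 ⟨by linarith [h1.1, h3.2], by linarith [h1.2, h3.1]⟩
  linarith [dist_le_add x y]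

/-- The index of the triadic interval of length `3⁻ⁿ` containing the `j`-th coordinate. -/
noncomputable def gridIndex (n : ℕ) (j : Fin 2) (x : carpet) : ℕ := ⌊3 ^ n * x.1 j⌋₊

lemma gridIndex_cellMap (n : ℕ) (i : Fin 8) (j : Fin 2) (x : carpet) :
    gridIndex (n + 1) j (cellMap i x) = gridIndex n j x + 3 ^ n * digit i j := by
  have h := (coord_mem x j).1
  rw [gridIndex, gridIndex, cellMap_apply, ← Nat.floor_add_natCast (by positivity)]
  congr 1
  push_cast
  ring

lemma measurable_gridIndex (n : ℕ) (j : Fin 2) : Measurable (gridIndex n j) :=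
  Nat.measurable_floor.comp ((measurable_coord j).const_mul _)

lemma gridIndex_lt {n : ℕ} {j : Fin 2} {x : carpet} (hx : x.1 j ≠ 1) : gridIndex n j x < 3 ^ n := by
  have h := coord_mem x j
  have h1 : x.1 j < 1 := lt_of_le_of_ne h.2 hx
  have h0 := h.1
  rw [gridIndex, Nat.floor_lt (by positivity)]
  push_cast
  have : (0 : ℝ) < 3 ^ n := by positivity
  nlinarith

lemma gridIndex_le_add_one {n : ℕ} {x y : carpet} (h : dist x y ≤ (1 / 3) ^ n) (j : Fin 2) :
    gridIndex n j y ≤ gridIndex n j x + 1 := by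
  have h1 := (abs_le.1 ((abs_coord_sub_le x y j).trans h)).1
  have hx := (coord_mem x j).1
  have h3 : (3 : ℝ) ^ n * (1 / 3) ^ n = 1 := by rw [← mul_pow]; norm_num
  have hp : (0 : ℝ) < 3 ^ n := by positivity
  rw [gridIndex, gridIndex, ← Nat.floor_add_one (by positivity)]
  apply Nat.floor_le_floor
  nlinarith

lemma coord_bounds_of_gridIndex (n : ℕ) (j : Fin 2) (x : carpet) :
    gridIndex n j x * (1 / 3 : ℝ) ^ n ≤ x.1 j ∧ x.1 j ≤ (gridIndex n j x + 1) * (1 / 3 : ℝ) ^ n := by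
  have hx := (coord_mem x j).1
  have h3 : (3 : ℝ) ^ n * (1 / 3) ^ n = 1 := by rw [← mul_pow]; norm_num
  have hp : (0 : ℝ) < (1 / 3) ^ n := by positivity
  have h1 := Nat.floor_le (show 0 ≤ (3 : ℝ) ^ n * x.1 j by positivity)
  have h2 := (Nat.lt_floor_add_one ((3 : ℝ) ^ n * x.1 j)).le
  constructor
  · calc _ ≤ (3 : ℝ) ^ n * x.1 j * (1 / 3 : ℝ) ^ n := by unfold gridIndex; gcongr
      _ = (3 : ℝ) ^ n * (1 / 3 : ℝ) ^ n * x.1 j := by ring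
      _ = _ := by rw [h3, one_mul]
  · calc x.1 j = (3 : ℝ) ^ n * (1 / 3 : ℝ) ^ n * x.1 j := by rw [h3, one_mul]
      _ = (3 : ℝ) ^ n * x.1 j * (1 / 3 : ℝ) ^ n := by ring
      _ ≤ _ := by unfold gridIndex; gcongr

/-- The part of the carpet in the half-open triadic square of side `3⁻ⁿ` with index `k`. -/
def gridSquare (n : ℕ) (k : Fin 2 → ℕ) : Set carpet := {x | ∀ j, gridIndex n j x = k j}

lemma measurableSet_gridSquare (n : ℕ) (k : Fin 2 → ℕ) : MeasurableSet (gridSquare n k) := by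
  rw [gridSquare, Set.ofPred_forall]
  exact MeasurableSet.iInter fun j => measurable_gridIndex n j (measurableSet_singleton _)

/-- A probability measure with `μ = (1/8) ∑ i, (f_i)_* μ`. -/
structure IsSelfSimilar (μ : Measure carpet) : Prop where
  prob : IsProbabilityMeasure μ
  eq_sum : ∀ A, MeasurableSet A → 8 * μ A = ∑ i, μ (cellMap i ⁻¹' A)

/-! ### Mass of sides, grid squares and balls. -/

namespace IsSelfSimilar

/-- Three of the eight preimages of the side `x_j = 1` lie in that side and the other five are
empty, so its mass `e` satisfies `8e ≤ 3e`. The half-open grid squares can therefore ignore this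
side. -/
lemma measure_edge {μ : Measure carpet} (hμ : IsSelfSimilar μ)
    (j : Fin 2) : μ {x | x.1 j = 1} = 0 := by
  have := hμ.prob
  have hA : MeasurableSet {x : carpet | x.1 j = 1} := measurable_coord j (measurableSet_singleton _)
  have h := hμ.eq_sum _ hA
  set e := μ {x : carpet | x.1 j = 1}
  have hpre : ∀ i, μ (cellMap i ⁻¹' {x | x.1 j = 1}) ≤ if digit i j = 2 then e else 0 := by
    intro i
    split_ifs with hi
    · refine measure_mono fun x hx => ?_
      simp only [Set.mem_preimage, Set.mem_ofPred_eq, cellMap_apply, hi] at hx ⊢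
      push_cast at hx
      linarith
    · have : cellMap i ⁻¹' {x | x.1 j = 1} = ∅ := by
        refine Set.eq_empty_of_forall_notMem fun x hx => ?_
        simp only [Set.mem_preimage, Set.mem_ofPred_eq, cellMap_apply] at hx
        have h1 : digit i j ≤ 1 := by have := digit_le i j; omega
        have h2 : (digit i j : ℝ) ≤ 1 := by exact_mod_cast h1
        linarith [(coord_mem x j).2]
      simp [this]
  have h8 : 8 * e ≤ 3 * e := by
    rw [h]
    refine (Finset.sum_le_sum fun i _ => hpre i).trans ?_
    have : (∑ i, if digit i j = 2 then e else 0) = 3 * e := by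
      rw [← Finset.sum_filter, Finset.sum_const, nsmul_eq_mul]
      congr 1
      fin_cases j
      · have : (Finset.univ.filter fun i => digit i 0 = 2).card = 3 := by decide
        exact_mod_cast this
      · have : (Finset.univ.filter fun i => digit i 1 = 2).card = 3 := by decide
        exact_mod_cast this
    exact this.le
  have hfin : e ≠ ⊤ := measure_ne_top _ _
  clear_value e
  lift e to NNReal using hfin
  have h9 : (8 : NNReal) * e ≤ 3 * e := by exact_mod_cast h8
  have h10 : e ≤ 0 := by
    have : (8 : ℝ) * e ≤ 3 * e := by exact_mod_cast h9
    have : (e : ℝ) ≤ 0 := by linarith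
    exact_mod_cast this
  exact_mod_cast le_antisymm h10 bot_le

lemma ae_coord_ne {μ : Measure carpet} (hμ : IsSelfSimilar μ)
    : ∀ᵐ x ∂μ, ∀ j : Fin 2, x.1 j ≠ 1 := by
  rw [ae_all_iff]
  intro j
  rw [ae_iff]
  simpa using hμ.measure_edge j

/-- Up to the null side, only the map `f_i` whose digits are the leading triadic digits of `k`
reaches the square, and its preimage lies in a square of the previous level. -/
lemma measure_gridSquare_le {μ : Measure carpet} (hμ : IsSelfSimilar μ)
    (n : ℕ) (k : Fin 2 → ℕ) :
    8 ^ n * μ (gridSquare n k) ≤ 1 := by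
  have := hμ.prob
  induction n generalizing k with
  | zero => simpa using prob_le_one
  | succ n ih =>
    rw [pow_succ, mul_assoc, hμ.eq_sum _ (measurableSet_gridSquare _ _)]
    have hnull : ∀ i, (∃ j, digit i j ≠ k j / 3 ^ n) →
        μ (cellMap i ⁻¹' gridSquare (n + 1) k) = 0 := by
      rintro i ⟨j, hj⟩
      refine measure_mono_null (fun x hx => ?_) (hμ.measure_edge j)
      by_contra hne
      apply hj
      have h1 := hx j
      rw [gridIndex_cellMap] at h1
      rw [← h1, Nat.add_mul_div_left _ _ (by positivity), Nat.div_eq_of_lt (gridIndex_lt hne),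
        zero_add]
    have hle : ∀ i, 8 ^ n * μ (cellMap i ⁻¹' gridSquare (n + 1) k) ≤ 1 := by
      intro i
      -- If the subtraction truncates, the preimage is empty, so the inclusion still holds.
      refine le_trans ?_ (ih fun j => k j - 3 ^ n * digit i j)
      gcongr
      intro x hx j
      have h1 := hx j
      rw [gridIndex_cellMap] at h1
      simp only
      omega
    by_cases hex : ∃ i, ∀ j, digit i j = k j / 3 ^ n
    · obtain ⟨i, hi⟩ := hex
      rw [Finset.sum_eq_single i]
      · exact hle i
      · intro i' _ hne
        apply hnull
        by_contra! hcon
        exact hne (digit_injective (funext fun j => (hcon j).trans (hi j).symm))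
      · simp
    · push Not at hex
      rw [Finset.sum_eq_zero fun i _ => hnull i (hex i)]
      simp

lemma measure_le_of_dist_le {μ : Measure carpet} (hμ : IsSelfSimilar μ)
    (n : ℕ) (x : carpet) (s : Set carpet)
    (hs : ∀ y ∈ s, dist x y ≤ (1 / 3) ^ n) : 8 ^ n * μ s ≤ 9 := by
  -- The offsets `-1, 0, 1` are written `a - 1`. At index `0` truncation merely repeats a square,
  -- which is harmless in an upper bound by nine squares.
  have hsub : s ⊆ ⋃ a : Fin 2 → Fin 3, gridSquare n fun j => gridIndex n j x + a j - 1 := by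
    intro y hy
    have h1 := gridIndex_le_add_one (hs y hy)
    have h2 := gridIndex_le_add_one (dist_comm x y ▸ hs y hy)
    refine Set.mem_iUnion.2 ⟨fun j => ⟨gridIndex n j y + 1 - gridIndex n j x, ?_⟩, fun j => ?_⟩
    · have := h1 j; omega
    · have := h2 j
      have := h1 j
      simp only
      omega
  calc 8 ^ n * μ s
      ≤ 8 ^ n * ∑ a : Fin 2 → Fin 3, μ (gridSquare n fun j => gridIndex n j x + a j - 1) := by
        gcongr
        exact (measure_mono hsub).trans (measure_iUnion_fintype_le _ _)
    _ ≤ ∑ a : Fin 2 → Fin 3, 1 := by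
        rw [Finset.mul_sum]
        exact Finset.sum_le_sum fun a _ => hμ.measure_gridSquare_le n _
    _ = 9 := by simp

lemma le_measure_gridSquare {μ : Measure carpet} (hμ : IsSelfSimilar μ)
    (n : ℕ) (k : Fin 2 → ℕ) (i : Fin 8) :
    μ (gridSquare n k) ≤ 8 * μ (gridSquare (n + 1) fun j => k j + 3 ^ n * digit i j) := by
  rw [hμ.eq_sum _ (measurableSet_gridSquare _ _)]
  refine le_trans (measure_mono ?_)
    (Finset.single_le_sum (f := fun i' => μ (cellMap i' ⁻¹' gridSquare (n + 1) fun j =>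
      k j + 3 ^ n * digit i j)) (fun _ _ => bot_le) (Finset.mem_univ i))
  intro x hx j
  rw [gridIndex_cellMap, hx j]

/-- Descend through the cells containing `x`: each `f_i` shrinks radii by `3` and costs a factor `8`
in mass. The factor `2` makes the ball of level `0` the whole carpet. -/
lemma le_measure_closedBall {μ : Measure carpet} (hμ : IsSelfSimilar μ) (n : ℕ) (x : carpet) :
    1 ≤ 8 ^ n * μ (Metric.closedBall x (2 * (1 / 3) ^ n)) := by
  have := hμ.prob
  induction n generalizing x with
  | zero =>
    have : Metric.closedBall x (2 * (1 / 3) ^ 0) = Set.univ :=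
      Set.eq_univ_of_forall fun y => by simpa using dist_le_two y x
    rw [this]
    simp
  | succ n ih =>
    obtain ⟨i, y, rfl⟩ := exists_cellMap_eq x
    refine (ih y).trans ?_
    rw [pow_succ 8, mul_assoc, hμ.eq_sum _ Metric.isClosed_closedBall.measurableSet]
    gcongr
    refine le_trans (measure_mono fun z hz => ?_)
      (Finset.single_le_sum (f := fun i' => μ (cellMap i' ⁻¹'
        Metric.closedBall (cellMap i y) (2 * (1 / 3) ^ (n + 1)))) (fun _ _ => bot_le)
        (Finset.mem_univ i))
    rw [Metric.mem_closedBall] at hz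
    rw [Set.mem_preimage, Metric.mem_closedBall, dist_cellMap, pow_succ]
    linarith

end IsSelfSimilar

/-- The natural numbers below `3ⁿ` all of whose triadic digits are `0` or `2`. -/
def cantorRows : ℕ → Finset ℕ
  | 0 => {0}
  | n + 1 => cantorRows n ∪ (cantorRows n).image (· + 2 * 3 ^ n)

lemma lt_of_mem_cantorRows {n l : ℕ} (h : l ∈ cantorRows n) : l < 3 ^ n := by
  induction n generalizing l with
  | zero => simp_all [cantorRows]
  | succ n ih =>
    rw [cantorRows, Finset.mem_union, Finset.mem_image] at h
    rw [pow_succ]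
    rcases h with h | ⟨m, h, rfl⟩
    · have := ih h; omega
    · have := ih h; omega

lemma card_cantorRows (n : ℕ) : (cantorRows n).card = 2 ^ n := by
  induction n with
  | zero => simp [cantorRows]
  | succ n ih =>
    rw [cantorRows, Finset.card_union_of_disjoint, Finset.card_image_of_injective, ih, pow_succ,
      mul_two]
    · exact add_left_injective _
    · rw [Finset.disjoint_left]
      intro a ha hb
      obtain ⟨m, -, rfl⟩ := Finset.mem_image.1 hb
      have := lt_of_mem_cantorRows ha
      omega

/-- The only missing digit pair is `(1, 1)`. With row digits in `{0, 2}` every column digit is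
allowed, so each square of such a row is a full cell. The induction peels off the leading digit. -/
lemma IsSelfSimilar.le_measure_gridSquare_cantorRows {μ : Measure carpet} (hμ : IsSelfSimilar μ)
    {n k l : ℕ} (hk : k < 3 ^ n) (hl : l ∈ cantorRows n) : 1 ≤ 8 ^ n * μ (gridSquare n ![k, l]) := by
  have := hμ.prob
  induction n generalizing k l with
  | zero =>
    have h : μ (gridSquare 0 ![k, l]) = 1 := by
      rw [← mem_ae_iff_prob_eq_one (measurableSet_gridSquare _ _)]
      filter_upwards [hμ.ae_coord_ne] with x hx j
      have h0 : k = 0 := by simpa using hk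
      have h1 : l = 0 := by simpa [cantorRows] using hl
      have := gridIndex_lt (n := 0) (hx j)
      rw [pow_zero, Nat.lt_one_iff] at this
      rw [this]
      fin_cases j <;> simp [h0, h1]
    simp [h]
  | succ n ih =>
    have key : ∀ d e k' l', (∃ i, digit i = ![d, e]) → k' < 3 ^ n → l' ∈ cantorRows n →
        1 ≤ 8 ^ (n + 1) * μ (gridSquare (n + 1) ![k' + 3 ^ n * d, l' + 3 ^ n * e]) := by
      rintro d e k' l' ⟨i, hi⟩ hk' hl'
      refine (ih hk' hl').trans ?_
      rw [pow_succ 8, mul_assoc]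
      gcongr
      have hv : ![k' + 3 ^ n * d, l' + 3 ^ n * e] = fun j => ![k', l'] j + 3 ^ n * digit i j := by
        ext j
        fin_cases j <;> simp [hi]
      rw [hv]
      exact hμ.le_measure_gridSquare n ![k', l'] i
    have hd : k / 3 ^ n < 3 := Nat.div_lt_of_lt_mul (by rwa [← pow_succ])
    have hk' : k % 3 ^ n < 3 ^ n := Nat.mod_lt _ (by positivity)
    have hkk := Nat.mod_add_div k (3 ^ n)
    have hex : ∀ d < 3, ∀ e, e = 0 ∨ e = 2 → ∃ i, digit i = ![d, e] := by
      intro d hd e he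
      rcases he with rfl | rfl <;> interval_cases d <;> decide
    rw [cantorRows, Finset.mem_union, Finset.mem_image] at hl
    rcases hl with hl | ⟨l', hl, rfl⟩
    · have := key _ 0 _ l (hex _ hd 0 (Or.inl rfl)) hk' hl
      rwa [hkk, mul_zero, add_zero] at this
    · have := key _ 2 _ l' (hex _ hd 2 (Or.inr rfl)) hk' hl
      rwa [hkk, mul_comm (3 ^ n) 2] at this

end SierpinskiCarpet

namespace SierpinskiCarpet

/-! ### Existence of a self-similar measure -/

/-- The uniform distribution on the eight symbols. -/
noncomputable def symbolMeasure : Measure (Fin 8) := (8 : ENNReal)⁻¹ • ∑ i, Measure.dirac i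

lemma symbolMeasure_apply (S : Set (Fin 8)) :
    8 * symbolMeasure S = ∑ i, S.indicator 1 i := by
  simp only [symbolMeasure, Measure.smul_apply, Measure.finsetSum_apply, smul_eq_mul]
  rw [← mul_assoc, ENNReal.mul_inv_cancel (by norm_num) (by norm_num), one_mul]
  exact Finset.sum_congr rfl fun i _ => Measure.dirac_apply' _ (Set.toFinite S).measurableSet

instance : IsProbabilityMeasure symbolMeasure := by
  constructor
  have h := symbolMeasure_apply Set.univ
  have h8 : (8 : ENNReal) ≠ 0 := by norm_num
  simp only [Set.indicator_univ, Pi.one_apply, Finset.sum_const, Finset.card_univ,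
    Fintype.card_fin, nsmul_eq_mul, mul_one] at h
  exact (ENNReal.mul_right_inj h8 (by norm_num)).1 (by simpa using h)

/-- The Bernoulli measure on sequences of symbols. -/
noncomputable def bernoulli : Measure (ℕ → Fin 8) := Measure.infinitePi fun _ => symbolMeasure

/-- Put a symbol in front of a sequence. -/
def consSeq (i : Fin 8) (ω : ℕ → Fin 8) : ℕ → Fin 8
  | 0 => i
  | n + 1 => ω n

lemma measurable_consSeq (i : Fin 8) : Measurable (consSeq i) :=
  measurable_pi_lambda _ fun n => by
    cases n with
    | zero => exact measurable_const
    | succ n => exact measurable_pi_apply n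

lemma bernoulli_box (N : ℕ) (t : ℕ → Set (Fin 8)) :
    bernoulli (Set.pi (Finset.range N) t) = ∏ n ∈ Finset.range N, symbolMeasure (t n) :=
  Measure.infinitePi_pi _ fun _ _ => (Set.toFinite _).measurableSet

/-- Putting an independent uniform symbol in front of an i.i.d. uniform sequence does not change its
law. This is checked on boxes, where the factor of coordinate `0` splits off. -/
lemma bernoulli_eq_sum {A : Set (ℕ → Fin 8)} (hA : MeasurableSet A) :
    8 * bernoulli A = ∑ i, bernoulli (consSeq i ⁻¹' A) := by
  classical
  have h8 : (8 : ENNReal) * 8⁻¹ = 1 := ENNReal.mul_inv_cancel (by norm_num) (by norm_num)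
  have key : (8 : ENNReal)⁻¹ • ∑ i, bernoulli.map (consSeq i) = bernoulli := by
    refine Measure.eq_infinitePi _ fun s t ht => ?_
    obtain ⟨N, hN⟩ : ∃ N, s ⊆ Finset.range (N + 1) :=
      ⟨s.sup id, fun n hn => Finset.mem_range_succ_iff.2 (Finset.le_sup (f := id) hn)⟩
    -- Padding with the full set turns the index set into an initial segment containing `0`.
    set t' : ℕ → Set (Fin 8) := fun n => if n ∈ s then t n else Set.univ with ht'
    have hbox : Set.pi s t = Set.pi (Finset.range (N + 1)) t' := by
      ext ω
      simp only [Set.mem_pi, Finset.mem_coe, ht']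
      constructor
      · intro h n _
        split_ifs with hn
        · exact h n hn
        · trivial
      · intro h n hn
        simpa [hn] using h n (hN hn)
    have hprod : ∏ n ∈ s, symbolMeasure (t n) = ∏ n ∈ Finset.range (N + 1), symbolMeasure (t' n) := by
      rw [← Finset.prod_subset hN]
      · exact Finset.prod_congr rfl fun n hn => by simp [ht', hn]
      · intro n _ hn
        simp [ht', hn]
    have hpre : ∀ i, bernoulli.map (consSeq i) (Set.pi (Finset.range (N + 1)) t') =
        (t' 0).indicator 1 i * ∏ n ∈ Finset.range N, symbolMeasure (t' (n + 1)) := by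
      intro i
      rw [Measure.map_apply (measurable_consSeq i)
        (MeasurableSet.pi (Finset.countable_toSet _) fun _ _ => (Set.toFinite _).measurableSet)]
      by_cases hi : i ∈ t' 0
      · rw [← bernoulli_box N fun n => t' (n + 1), Set.indicator_of_mem hi, Pi.one_apply, one_mul]
        congr 1
        ext ω
        simp only [Set.mem_preimage, Set.mem_pi, Finset.mem_coe, Finset.mem_range]
        constructor
        · intro h n hn
          exact h (n + 1) (by omega)
        · intro h n hn
          cases n with
          | zero => exact hi
          | succ n => exact h n (by omega)
      · rw [Set.indicator_of_notMem hi, zero_mul]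
        convert measure_empty (μ := bernoulli)
        refine Set.eq_empty_of_forall_notMem fun ω h => hi ?_
        exact h 0 (by simp)
    rw [hbox, hprod, Measure.smul_apply, Measure.finsetSum_apply, smul_eq_mul,
      Finset.sum_congr rfl fun i _ => hpre i, ← Finset.sum_mul, ← symbolMeasure_apply,
      Finset.prod_range_succ', ← mul_assoc, ← mul_assoc, mul_comm (8⁻¹ : ENNReal), h8, one_mul,
      mul_comm]
  conv_lhs => rw [← key]
  rw [Measure.smul_apply, Measure.finsetSum_apply, smul_eq_mul, ← mul_assoc, h8, one_mul]
  exact Finset.sum_congr rfl fun i _ => Measure.map_apply (measurable_consSeq i) hA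

/-! ### The coding map. -/

lemma norm_vertex_le (i : Fin 8) : ‖vertex i‖ ≤ 2 := by
  rw [EuclideanSpace.norm_eq, Fin.sum_univ_two, Real.norm_eq_abs, Real.norm_eq_abs]
  refine Real.sqrt_le_iff.2 ⟨by norm_num, ?_⟩
  have h0 := vertex_mem i 0
  have h1 := vertex_mem i 1
  rw [sq_abs, sq_abs]
  nlinarith [h0.1, h0.2, h1.1, h1.2]

/-- The point of the plane coded by a sequence of symbols. -/
noncomputable def codingMap (ω : ℕ → Fin 8) : Plane := ∑' n, (1 / 3 : ℝ) ^ n • (2 / 3 : ℝ) • vertex (ω n)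

lemma norm_codingMap_term_le (n : ℕ) (i : Fin 8) :
    ‖(1 / 3 : ℝ) ^ n • (2 / 3 : ℝ) • vertex i‖ ≤ (1 / 3 : ℝ) ^ n * 2 := by
  rw [norm_smul, norm_smul, Real.norm_of_nonneg (by positivity), Real.norm_of_nonneg (by norm_num)]
  have := norm_vertex_le i
  gcongr
  linarith

lemma summable_bound : Summable fun n : ℕ => (1 / 3 : ℝ) ^ n * 2 :=
  (summable_geometric_of_lt_one (by norm_num) (by norm_num)).mul_right _

lemma summable_codingMap (ω : ℕ → Fin 8) :
    Summable fun n => (1 / 3 : ℝ) ^ n • (2 / 3 : ℝ) • vertex (ω n) :=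
  Summable.of_norm_bounded summable_bound fun n => norm_codingMap_term_le n (ω n)

lemma continuous_codingMap : Continuous codingMap := by
  refine continuous_tsum (fun n => ?_) summable_bound fun n ω => norm_codingMap_term_le n (ω n)
  have : Continuous fun i : Fin 8 => (1 / 3 : ℝ) ^ n • (2 / 3 : ℝ) • vertex i :=
    continuous_of_discreteTopology
  exact this.comp (continuous_apply n)

lemma codingMap_eq (ω : ℕ → Fin 8) :
    codingMap ω = contraction (ω 0) (codingMap fun n => ω (n + 1)) := by
  rw [codingMap, (summable_codingMap ω).tsum_eq_zero_add, contraction, codingMap, smul_add,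
    ← (summable_codingMap fun n => ω (n + 1)).tsum_const_smul, add_comm, pow_zero, one_smul,
    smul_smul (1 / 3 : ℝ) 2]
  congr 1
  · exact tsum_congr fun n => by rw [pow_succ', mul_smul]
  · norm_num

lemma codingMap_mem_unitSquare (ω : ℕ → Fin 8) : codingMap ω ∈ unitSquare := by
  intro j
  have h1 : HasSum (fun n => (1 / 3 : ℝ) ^ n * (2 / 3 * vertex (ω n) j)) (codingMap ω j) :=
    (summable_codingMap ω).hasSum.mapL (EuclideanSpace.proj (𝕜 := ℝ) j)
  have h2 : HasSum (fun n : ℕ => (1 / 3 : ℝ) ^ n * (2 / 3 * 1)) 1 := by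
    have h := (hasSum_geometric_of_lt_one (r := (1 / 3 : ℝ)) (by norm_num) (by norm_num)).mul_right
      (2 / 3 * 1)
    rwa [show (1 - 1 / 3 : ℝ)⁻¹ * (2 / 3 * 1) = 1 by norm_num] at h
  refine ⟨h1.nonneg fun n => ?_, hasSum_le (fun n => ?_) h1 h2⟩
  · have := (vertex_mem (ω n) j).1
    positivity
  · have := (vertex_mem (ω n) j).2
    gcongr

lemma codingMap_mem (ω : ℕ → Fin 8) : codingMap ω ∈ carpet := by
  refine Set.mem_iInter.2 fun n => ?_
  induction n generalizing ω with
  | zero => exact codingMap_mem_unitSquare ω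
  | succ n ih =>
    rw [Function.iterate_succ_apply', codingMap_eq]
    exact Set.mem_iUnion.2 ⟨_, _, ih _, rfl⟩

/-- The coding map intertwines `consSeq i` with `f_i`, so it pushes the Bernoulli measure to a
self-similar one. This measure serves only to show that the Hausdorff measure is nonzero. -/
lemma exists_isSelfSimilar : ∃ μ : Measure carpet, IsSelfSimilar μ := by
  have hm : Measurable fun ω => (⟨codingMap ω, codingMap_mem ω⟩ : carpet) :=
    continuous_codingMap.measurable.subtype_mk
  have hb : IsProbabilityMeasure bernoulli := by unfold bernoulli; infer_instance
  refine ⟨bernoulli.map fun ω => ⟨codingMap ω, codingMap_mem ω⟩,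
    Measure.isProbabilityMeasure_map hm.aemeasurable, fun A hA => ?_⟩
  rw [Measure.map_apply hm hA, bernoulli_eq_sum (hm hA)]
  refine Finset.sum_congr rfl fun i _ => ?_
  rw [Measure.map_apply hm (measurable_cellMap i hA)]
  congr 1
  ext ω
  have hc : (⟨codingMap (consSeq i ω), codingMap_mem _⟩ : carpet) =
      cellMap i ⟨codingMap ω, codingMap_mem ω⟩ := Subtype.ext (codingMap_eq (consSeq i ω))
  rw [Set.mem_preimage, Set.mem_preimage, Set.mem_preimage, Set.mem_preimage, hc]

/-! ### The Hausdorff measure of the carpet -/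

lemma hausdorffDim_pos : 0 < hausdorffDim :=
  div_pos (Real.log_pos (by norm_num)) (Real.log_pos (by norm_num))

lemma three_rpow_hausdorffDim : (3 : ℝ) ^ hausdorffDim = 8 := by
  have h : Real.log 3 ≠ 0 := (Real.log_pos (by norm_num)).ne'
  rw [Real.rpow_def_of_pos (by norm_num), hausdorffDim, mul_div_cancel₀ _ h,
    Real.exp_log (by norm_num)]

lemma third_rpow_hausdorffDim (n : ℕ) : ((1 / 3 : ℝ) ^ n) ^ hausdorffDim = (1 / 8) ^ n := by
  rw [← Real.rpow_natCast, ← Real.rpow_mul (by norm_num), mul_comm, Real.rpow_mul (by norm_num),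
    Real.div_rpow (by norm_num) (by norm_num), three_rpow_hausdorffDim, Real.one_rpow,
    Real.rpow_natCast]

/-- For `3^(-n-1) < D ≤ 3⁻ⁿ` the bound `9 · 8⁻ⁿ` is at most `72 D^α`, with `72 = 9 · 8`. For `D = 0`
let `n → ∞`. -/
lemma IsSelfSimilar.measure_le_rpow {μ : Measure carpet} (hμ : IsSelfSimilar μ) {s : Set carpet}
    {D : ℝ} (hD : D ≤ 1) (hs : ∀ x ∈ s, ∀ y ∈ s, dist x y ≤ D) :
    μ s ≤ ENNReal.ofReal (72 * D ^ hausdorffDim) := by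
  have := hμ.prob
  rcases s.eq_empty_or_nonempty with rfl | ⟨x, hx⟩
  · simp
  have h8 : ∀ n : ℕ, (8 : ENNReal) ^ n * ENNReal.ofReal ((1 / 8) ^ n) = 1 := by
    intro n
    rw [ENNReal.ofReal_pow (by norm_num), ← mul_pow, show (8 : ENNReal) = ENNReal.ofReal 8 by simp,
      ← ENNReal.ofReal_mul (by norm_num)]
    norm_num
  have hball : ∀ n : ℕ, D ≤ (1 / 3) ^ n → μ s ≤ ENNReal.ofReal (9 * (1 / 8) ^ n) := by
    intro n hn
    have h := hμ.measure_le_of_dist_le n x s fun y hy => (hs x hx y hy).trans hn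
    calc μ s = ENNReal.ofReal ((1 / 8) ^ n) * (8 ^ n * μ s) := by
          rw [← mul_assoc, mul_comm (ENNReal.ofReal _), h8, one_mul]
      _ ≤ ENNReal.ofReal ((1 / 8) ^ n) * 9 := by gcongr
      _ = _ := by
          rw [mul_comm, ENNReal.ofReal_mul (by norm_num)]
          simp
  have hD0 : 0 ≤ D := dist_nonneg.trans (hs x hx x hx)
  rcases hD0.eq_or_lt with rfl | hpos
  · have hlim : Tendsto (fun n : ℕ => ENNReal.ofReal (9 * (1 / 8) ^ n)) atTop (𝓝 0) := by
      rw [← ENNReal.ofReal_zero]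
      refine ENNReal.tendsto_ofReal ?_
      simpa using (tendsto_pow_atTop_nhds_zero_of_lt_one (r := (1 / 8 : ℝ)) (by norm_num)
        (by norm_num)).const_mul 9
    exact (ge_of_tendsto' hlim fun n => hball n (by positivity)).trans bot_le
  · obtain ⟨n, hn1, hn2⟩ := exists_nat_pow_near_of_lt_one hpos hD (y := (1 / 3 : ℝ)) (by norm_num)
      (by norm_num)
    refine (hball n hn2).trans (ENNReal.ofReal_le_ofReal ?_)
    have h1 : ((1 / 3 : ℝ) ^ (n + 1)) ^ hausdorffDim ≤ D ^ hausdorffDim :=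
      Real.rpow_le_rpow (by positivity) hn1.le hausdorffDim_pos.le
    rw [third_rpow_hausdorffDim, pow_succ] at h1
    linarith

/-- The Hausdorff measure of dimension `hausdorffDim` on the carpet. -/
noncomputable abbrev hausdorff : Measure carpet := Measure.hausdorffMeasure hausdorffDim

/-- Mass distribution principle: a probability measure with `μ(s) ≤ 72 diam(s)^α` for small `s` is
dominated by `72` times the Hausdorff measure. -/
lemma hausdorff_univ_ne_zero : hausdorff Set.univ ≠ 0 := by
  obtain ⟨μ, hμ⟩ := exists_isSelfSimilar
  have := hμ.prob
  have hle : (72 : ENNReal)⁻¹ • μ ≤ hausdorff := by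
    refine Measure.le_hausdorffMeasure _ _ 1 one_pos fun s hs => ?_
    have hne : Metric.ediam s ≠ ⊤ := ne_top_of_le_ne_top ENNReal.one_ne_top hs
    have h := hμ.measure_le_rpow (s := s) (D := (Metric.ediam s).toReal)
      (ENNReal.toReal_le_of_le_ofReal zero_le_one (by simpa using hs)) fun x hx y hy => by
        rw [dist_edist]
        exact ENNReal.toReal_mono hne (Metric.edist_le_ediam_of_mem hx hy)
    rw [Measure.smul_apply, smul_eq_mul]
    rw [ENNReal.ofReal_mul (by norm_num), ← ENNReal.ofReal_rpow_of_nonneg ENNReal.toReal_nonneg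
      hausdorffDim_pos.le, ENNReal.ofReal_toReal hne] at h
    calc (72 : ENNReal)⁻¹ * μ s ≤ 72⁻¹ * (ENNReal.ofReal 72 * Metric.ediam s ^ hausdorffDim) := by
          gcongr
      _ = _ := by
          rw [← mul_assoc, show ENNReal.ofReal 72 = 72 by simp,
            ENNReal.inv_mul_cancel (by norm_num) (by norm_num), one_mul]
  intro h0
  have h1 := hle Set.univ
  rw [h0, Measure.smul_apply, measure_univ] at h1
  simp at h1

lemma lipschitzWith_cellMap (i : Fin 8) : LipschitzWith (1 / 3) (cellMap i) :=
  LipschitzWith.of_dist_le_mul fun x y => by simp [dist_cellMap]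

/-- The cell of the carpet coded by a word of length `n`. -/
noncomputable def wordCell : (n : ℕ) → (Fin n → Fin 8) → Set carpet
  | 0, _ => Set.univ
  | n + 1, w => cellMap (w 0) '' wordCell n fun i => w i.succ

lemma ediam_wordCell_le (n : ℕ) (w : Fin n → Fin 8) :
    Metric.ediam (wordCell n w) ≤ ENNReal.ofReal (2 * (1 / 3) ^ n) := by
  induction n with
  | zero =>
    refine Metric.ediam_le fun x _ y _ => ?_
    rw [edist_dist]
    exact ENNReal.ofReal_le_ofReal (by simpa using dist_le_two x y)
  | succ n ih =>
    refine ((lipschitzWith_cellMap (w 0)).ediam_image_le _).trans ?_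
    calc ((1 / 3 : NNReal) : ENNReal) * Metric.ediam (wordCell n fun i => w i.succ)
        ≤ ENNReal.ofReal (1 / 3) * ENNReal.ofReal (2 * (1 / 3) ^ n) := by
          gcongr
          · rw [ENNReal.ofReal]
            apply ENNReal.coe_le_coe.2
            exact NNReal.le_toNNReal_of_coe_le (by norm_num)
          · exact ih _
      _ = _ := by
          rw [← ENNReal.ofReal_mul (by norm_num), pow_succ]
          ring_nf

lemma exists_mem_wordCell (n : ℕ) (x : carpet) : ∃ w, x ∈ wordCell n w := by
  induction n generalizing x with
  | zero => exact ⟨Fin.elim0, trivial⟩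
  | succ n ih =>
    obtain ⟨i, y, rfl⟩ := exists_cellMap_eq x
    obtain ⟨w, hw⟩ := ih y
    refine ⟨Fin.cons i w, Set.mem_image_of_mem _ ?_⟩
    simpa using hw

/-- The `8ⁿ` cells of level `n` have diameter at most `2 · 3⁻ⁿ`, so the sums of `α`-th powers stay
below `2^α`. -/
lemma hausdorff_univ_ne_top : hausdorff Set.univ ≠ ⊤ := by
  have hlim : Tendsto (fun n : ℕ => ENNReal.ofReal (2 * (1 / 3) ^ n)) atTop (𝓝 0) := by
    rw [← ENNReal.ofReal_zero]
    refine ENNReal.tendsto_ofReal ?_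
    simpa using (tendsto_pow_atTop_nhds_zero_of_lt_one (r := (1 / 3 : ℝ)) (by norm_num)
      (by norm_num)).const_mul 2
  have h := Measure.hausdorffMeasure_le_liminf_sum hausdorffDim (Set.univ : Set carpet) _ hlim
    wordCell (Eventually.of_forall ediam_wordCell_le)
    (Eventually.of_forall fun n x _ => Set.mem_iUnion.2 (exists_mem_wordCell n x))
  have hsum : ∀ n, ∑ w, Metric.ediam (wordCell n w) ^ hausdorffDim ≤
      ENNReal.ofReal (2 ^ hausdorffDim) := by
    intro n
    calc ∑ w, Metric.ediam (wordCell n w) ^ hausdorffDim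
        ≤ ∑ _w : Fin n → Fin 8, ENNReal.ofReal (2 ^ hausdorffDim * (1 / 8) ^ n) := by
          refine Finset.sum_le_sum fun w _ => ?_
          rw [← third_rpow_hausdorffDim, ← Real.mul_rpow (by norm_num) (by positivity),
            ← ENNReal.ofReal_rpow_of_nonneg (by positivity) hausdorffDim_pos.le]
          exact ENNReal.rpow_le_rpow (ediam_wordCell_le n w) hausdorffDim_pos.le
      _ = ENNReal.ofReal (8 ^ n * (2 ^ hausdorffDim * (1 / 8) ^ n)) := by
          rw [ENNReal.ofReal_mul (p := 8 ^ n) (by positivity), Finset.sum_const, nsmul_eq_mul]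
          simp [ENNReal.ofReal_pow]
      _ = _ := by
          congr 1
          rw [mul_left_comm, ← mul_pow]
          norm_num
  refine ne_top_of_le_ne_top ENNReal.ofReal_ne_top
    (h.trans (liminf_le_of_frequently_le' (Frequently.of_forall hsum)))

lemma hausdorff_image_le (i : Fin 8) (A : Set carpet) :
    8 * hausdorff (cellMap i '' A) ≤ hausdorff A := by
  have h := (lipschitzWith_cellMap i).hausdorffMeasure_image_le hausdorffDim_pos.le A
  have h3 : ((1 / 3 : NNReal) : ENNReal) ^ hausdorffDim = 8⁻¹ := by
    have : ((1 / 3 : NNReal) : ENNReal) = ENNReal.ofReal (1 / 3) := by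
      rw [ENNReal.ofReal_div_of_pos (by norm_num)]
      simp
    rw [this, ENNReal.ofReal_rpow_of_nonneg (by norm_num) hausdorffDim_pos.le]
    have h := third_rpow_hausdorffDim 1
    rw [pow_one, pow_one] at h
    rw [h, ENNReal.ofReal_div_of_pos (by norm_num)]
    simp
  rw [h3] at h
  calc 8 * hausdorff (cellMap i '' A) ≤ 8 * (8⁻¹ * hausdorff A) := by gcongr
    _ = hausdorff A := by
      rw [← mul_assoc, ENNReal.mul_inv_cancel (by norm_num) (by norm_num), one_mul]

lemma hausdorff_le_sum (A : Set carpet) :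
    8 * hausdorff A ≤ ∑ i, hausdorff (cellMap i ⁻¹' A) := by
  have hsub : A ⊆ ⋃ i, cellMap i '' (cellMap i ⁻¹' A) := by
    intro x hx
    obtain ⟨i, y, rfl⟩ := exists_cellMap_eq x
    exact Set.mem_iUnion.2 ⟨i, y, hx, rfl⟩
  calc 8 * hausdorff A ≤ 8 * ∑ i, hausdorff (cellMap i '' (cellMap i ⁻¹' A)) := by
        gcongr
        exact (measure_mono hsub).trans (measure_iUnion_fintype_le _ _)
    _ ≤ _ := by
        rw [Finset.mul_sum]
        exact Finset.sum_le_sum fun i _ => hausdorff_image_le i _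

instance : IsFiniteMeasure hausdorff := ⟨hausdorff_univ_ne_top.lt_top⟩

/-- Subadditivity and scaling give `≤` for both `A` and its complement. The two inequalities add up
to an equality of finite numbers, so each is an equality; no separate argument that cells overlap in
null sets is needed. -/
lemma hausdorff_eq_sum {A : Set carpet} (hA : MeasurableSet A) :
    8 * hausdorff A = ∑ i, hausdorff (cellMap i ⁻¹' A) := by
  refine le_antisymm (hausdorff_le_sum A) ?_
  have hc := hausdorff_le_sum Aᶜ
  have htot : ∑ i, hausdorff (cellMap i ⁻¹' A) + ∑ i, hausdorff (cellMap i ⁻¹' Aᶜ) =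
      8 * hausdorff A + 8 * hausdorff Aᶜ := by
    rw [← mul_add, measure_add_measure_compl hA, ← Finset.sum_add_distrib]
    simp only [Set.preimage_compl]
    rw [Finset.sum_congr rfl fun i _ => measure_add_measure_compl (measurable_cellMap i hA)]
    simp
  have hfin : 8 * hausdorff Aᶜ ≠ ⊤ := ENNReal.mul_ne_top (by norm_num) (measure_ne_top _ _)
  refine (ENNReal.add_le_add_iff_right hfin).1 ?_
  rw [← htot]
  gcongr

instance : IsProbabilityMeasure hausdorffProb := by
  constructor
  rw [hausdorffProb, Measure.smul_apply, smul_eq_mul]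
  exact ENNReal.inv_mul_cancel hausdorff_univ_ne_zero hausdorff_univ_ne_top

lemma isSelfSimilar_hausdorffProb : IsSelfSimilar hausdorffProb where
  prob := inferInstance
  eq_sum A hA := by
    simp only [hausdorffProb, Measure.smul_apply, smul_eq_mul]
    rw [mul_left_comm, hausdorff_eq_sum hA, Finset.mul_sum]

end SierpinskiCarpet

namespace SierpinskiCarpet

/-! ### The form as the graph form of a difference quotient operator -/

/-- The energy of a function on the carpet. -/
noncomputable def funEnergy (β : ℝ) (f : carpet → ℝ) : ENNReal :=
  ∫⁻ x, ∫⁻ y, ENNReal.ofReal ((f x - f y) ^ 2 / dist x y ^ (hausdorffDim + β))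
    ∂hausdorffProb ∂hausdorffProb

lemma funEnergy_congr {β : ℝ} {f g : carpet → ℝ} (h : f =ᵐ[hausdorffProb] g) :
    funEnergy β f = funEnergy β g := by
  refine lintegral_congr_ae ?_
  filter_upwards [h] with x hx
  refine lintegral_congr_ae ?_
  filter_upwards [h] with y hy
  rw [hx, hy]

/-- The square root of the integrand of the energy, with a sign. -/
noncomputable def diffQuot (β : ℝ) (f : carpet → ℝ) (p : carpet × carpet) : ℝ :=
  (f p.1 - f p.2) / dist p.1 p.2 ^ ((hausdorffDim + β) / 2)

lemma diffQuot_mul (β : ℝ) (f g : carpet → ℝ) (p : carpet × carpet) :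
    diffQuot β f p * diffQuot β g p =
      (f p.1 - f p.2) * (g p.1 - g p.2) / dist p.1 p.2 ^ (hausdorffDim + β) := by
  have h : dist p.1 p.2 ^ (hausdorffDim + β) = dist p.1 p.2 ^ ((hausdorffDim + β) / 2) *
      dist p.1 p.2 ^ ((hausdorffDim + β) / 2) := by
    rw [← sq, ← Real.rpow_natCast, ← Real.rpow_mul dist_nonneg]
    congr 1
    push_cast
    ring
  rw [h, diffQuot, diffQuot, div_mul_div_comm]

/-- The measure `ν × ν`. -/
noncomputable abbrev prodMeasure : Measure (carpet × carpet) := hausdorffProb.prod hausdorffProb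

lemma ae_fst {P : carpet → Prop} (h : ∀ᵐ x ∂hausdorffProb, P x) :
    ∀ᵐ p ∂prodMeasure, P p.1 :=
  Measure.quasiMeasurePreserving_fst.ae h

lemma ae_snd {P : carpet → Prop} (h : ∀ᵐ x ∂hausdorffProb, P x) :
    ∀ᵐ p ∂prodMeasure, P p.2 :=
  Measure.quasiMeasurePreserving_snd.ae h

lemma diffQuot_congr {β : ℝ} {f g : carpet → ℝ} (h : f =ᵐ[hausdorffProb] g) :
    diffQuot β f =ᵐ[prodMeasure] diffQuot β g := by
  filter_upwards [ae_fst h, ae_snd h] with p h1 h2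
  rw [diffQuot, diffQuot, h1, h2]

lemma aestronglyMeasurable_diffQuot (β : ℝ) {f : carpet → ℝ}
    (hf : AEStronglyMeasurable f hausdorffProb) :
    AEStronglyMeasurable (diffQuot β f) prodMeasure := by
  have hd : AEStronglyMeasurable
      (fun p : carpet × carpet => dist p.1 p.2 ^ ((hausdorffDim + β) / 2)) prodMeasure :=
    (measurable_dist.pow_const _).aestronglyMeasurable
  have h := (hf.comp_fst (ν := hausdorffProb)).sub (hf.comp_snd (μ := hausdorffProb))
  exact (h.aemeasurable.div hd.aemeasurable).aestronglyMeasurable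

lemma funEnergy_eq {β : ℝ} {f : carpet → ℝ} (hf : AEStronglyMeasurable f hausdorffProb) :
    funEnergy β f = ∫⁻ p, ENNReal.ofReal (diffQuot β f p ^ 2) ∂prodMeasure := by
  rw [lintegral_prod _ ((aestronglyMeasurable_diffQuot β hf).aemeasurable.pow_const 2).ennreal_ofReal]
  simp only [sq, diffQuot_mul]
  simp only [← sq]
  rfl

lemma memLp_diffQuot_iff {β : ℝ} {f : carpet → ℝ} (hf : AEStronglyMeasurable f hausdorffProb) :
    MemLp (diffQuot β f) 2 prodMeasure ↔ funEnergy β f < ⊤ := by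
  have hm := aestronglyMeasurable_diffQuot β hf
  rw [memLp_two_iff_integrable_sq hm, funEnergy_eq hf, Integrable,
    hasFiniteIntegral_iff_ofReal (Eventually.of_forall fun p => sq_nonneg _)]
  exact and_iff_right (hm.pow 2)

/-- The domain is that of the operator `u ↦ diffQuot β u` from `L²(ν)` to `L²(ν × ν)`. Linearity,
symmetry and closedness of the form are read off from this operator. -/
lemma mem_domain_iff {β : ℝ} {u : Lp ℝ 2 hausdorffProb} :
    u ∈ domain β ↔ MemLp (diffQuot β u) 2 prodMeasure :=
  (memLp_diffQuot_iff (Lp.aestronglyMeasurable u)).symm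

lemma diffQuot_add_ae (β : ℝ) (u v : Lp ℝ 2 hausdorffProb) :
    diffQuot β (u + v : Lp ℝ 2 hausdorffProb) =ᵐ[prodMeasure] diffQuot β u + diffQuot β v := by
  filter_upwards [diffQuot_congr (β := β) (Lp.coeFn_add u v)] with p hp
  rw [hp]
  simp only [diffQuot, Pi.add_apply]
  ring

lemma diffQuot_smul_ae (β c : ℝ) (u : Lp ℝ 2 hausdorffProb) :
    diffQuot β (c • u : Lp ℝ 2 hausdorffProb) =ᵐ[prodMeasure] c • diffQuot β u := by
  filter_upwards [diffQuot_congr (β := β) (Lp.coeFn_smul c u)] with p hp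
  rw [hp]
  simp only [diffQuot, Pi.smul_apply, smul_eq_mul]
  ring

lemma add_mem_domain {β : ℝ} {u v : Lp ℝ 2 hausdorffProb} (hu : u ∈ domain β) (hv : v ∈ domain β) :
    u + v ∈ domain β :=
  mem_domain_iff.2 (((mem_domain_iff.1 hu).add (mem_domain_iff.1 hv)).ae_eq
    (diffQuot_add_ae β u v).symm)

lemma smul_mem_domain {β : ℝ} (c : ℝ) {u : Lp ℝ 2 hausdorffProb} (hu : u ∈ domain β) :
    c • u ∈ domain β :=
  mem_domain_iff.2 (((mem_domain_iff.1 hu).const_smul c).ae_eq (diffQuot_smul_ae β c u).symm)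

lemma sub_mem_domain {β : ℝ} {u v : Lp ℝ 2 hausdorffProb} (hu : u ∈ domain β) (hv : v ∈ domain β) :
    u - v ∈ domain β := by
  have := add_mem_domain hu (smul_mem_domain (-1) hv)
  rwa [neg_one_smul, ← sub_eq_add_neg] at this

lemma zero_mem_domain (β : ℝ) : (0 : Lp ℝ 2 hausdorffProb) ∈ domain β := by
  rw [mem_domain_iff]
  have h : diffQuot β (0 : Lp ℝ 2 hausdorffProb) =ᵐ[prodMeasure] 0 := by
    filter_upwards [diffQuot_congr (β := β) (Lp.coeFn_zero ℝ 2 hausdorffProb)] with p hp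
    rw [hp]
    simp [diffQuot]
  exact MemLp.zero.ae_eq h.symm

/-- The difference quotient of an element of the domain, as an element of `L²(ν × ν)`. -/
noncomputable def diffQuotLp {β : ℝ} {u : Lp ℝ 2 hausdorffProb} (hu : u ∈ domain β) :
    Lp ℝ 2 prodMeasure :=
  (mem_domain_iff.1 hu).toLp

lemma diffQuotLp_add {β : ℝ} {u v : Lp ℝ 2 hausdorffProb} (hu : u ∈ domain β) (hv : v ∈ domain β) :
    diffQuotLp (add_mem_domain hu hv) = diffQuotLp hu + diffQuotLp hv := by
  rw [diffQuotLp, diffQuotLp, diffQuotLp, ← MemLp.toLp_add]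
  exact MemLp.toLp_congr _ _ (diffQuot_add_ae β u v)

lemma diffQuotLp_smul {β : ℝ} (c : ℝ) {u : Lp ℝ 2 hausdorffProb} (hu : u ∈ domain β) :
    diffQuotLp (smul_mem_domain c hu) = c • diffQuotLp hu := by
  rw [diffQuotLp, diffQuotLp, ← MemLp.toLp_const_smul]
  exact MemLp.toLp_congr _ _ (diffQuot_smul_ae β c u)

lemma diffQuotLp_sub {β : ℝ} {u v : Lp ℝ 2 hausdorffProb} (hu : u ∈ domain β) (hv : v ∈ domain β) :
    diffQuotLp (sub_mem_domain hu hv) = diffQuotLp hu - diffQuotLp hv := by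
  have h := diffQuotLp_add (sub_mem_domain hu hv) hv
  simp only [sub_add_cancel] at h
  exact eq_sub_of_add_eq h.symm

lemma form_eq_inner {β : ℝ} {u v : Lp ℝ 2 hausdorffProb} (hu : u ∈ domain β) (hv : v ∈ domain β) :
    form β u v = inner ℝ (diffQuotLp hu) (diffQuotLp hv) := by
  have hint : Integrable (fun p => diffQuot β u p * diffQuot β v p) prodMeasure :=
    (mem_domain_iff.1 hu).integrable_mul (mem_domain_iff.1 hv)
  have h1 : form β u v = ∫ p, diffQuot β u p * diffQuot β v p ∂prodMeasure := by
    rw [integral_prod _ hint]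
    simp only [diffQuot_mul]
    rfl
  rw [h1, L2.inner_def]
  refine integral_congr_ae ?_
  filter_upwards [(mem_domain_iff.1 hu).coeFn_toLp, (mem_domain_iff.1 hv).coeFn_toLp] with p h2 h3
  rw [diffQuotLp, diffQuotLp, h2, h3]
  simp [mul_comm]

lemma form_self {β : ℝ} {u : Lp ℝ 2 hausdorffProb} (hu : u ∈ domain β) :
    form β u u = (energy β u).toReal := by
  have h1 : form β u u = ∫ p, diffQuot β u p ^ 2 ∂prodMeasure := by
    have hint : Integrable (fun p => diffQuot β u p ^ 2) prodMeasure :=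
      (mem_domain_iff.1 hu).integrable_sq
    rw [integral_prod _ hint]
    simp only [sq, diffQuot_mul]
    rfl
  have h2 : energy β u = ∫⁻ p, ENNReal.ofReal (diffQuot β u p ^ 2) ∂prodMeasure :=
    funEnergy_eq (Lp.aestronglyMeasurable u)
  rw [h1, h2, integral_eq_lintegral_of_nonneg_ae (Eventually.of_forall fun p => sq_nonneg _)
    ((aestronglyMeasurable_diffQuot β (Lp.aestronglyMeasurable u)).pow 2)]

lemma formOne_sub {β : ℝ} {u v : Lp ℝ 2 hausdorffProb} (hu : u ∈ domain β) (hv : v ∈ domain β) :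
    formOne (form β) (u - v) (u - v) =
      dist (diffQuotLp hu) (diffQuotLp hv) ^ 2 + dist u v ^ 2 := by
  rw [formOne, form_eq_inner (sub_mem_domain hu hv) (sub_mem_domain hu hv), diffQuotLp_sub hu hv,
    real_inner_self_eq_norm_sq, real_inner_self_eq_norm_sq, dist_eq_norm, dist_eq_norm]

/-- The difference quotient operator is closed: along a common subsequence both convergences hold
almost everywhere, and `diffQuot` is a pointwise expression in `u`. -/
lemma exists_diffQuotLp_eq_of_tendsto {β : ℝ} {u : ℕ → Lp ℝ 2 hausdorffProb}
    (hu : ∀ n, u n ∈ domain β) {v : Lp ℝ 2 hausdorffProb} (hv : Tendsto u atTop (𝓝 v))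
    {w : Lp ℝ 2 prodMeasure} (hw : Tendsto (fun n => diffQuotLp (hu n)) atTop (𝓝 w)) :
    ∃ h : v ∈ domain β, diffQuotLp h = w := by
  obtain ⟨n, hn, hnv⟩ := (tendstoInMeasure_of_tendsto_Lp hv).exists_seq_tendsto_ae
  obtain ⟨k, hk, hkw⟩ :=
    (tendstoInMeasure_of_tendsto_Lp (hw.comp hn.tendsto_atTop)).exists_seq_tendsto_ae
  have hcoe : ∀ᵐ p ∂prodMeasure, ∀ m, diffQuotLp (hu m) p = diffQuot β (u m) p :=
    ae_all_iff.2 fun m => (mem_domain_iff.1 (hu m)).coeFn_toLp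
  have heq : diffQuot β v =ᵐ[prodMeasure] w := by
    filter_upwards [ae_fst hnv, ae_snd hnv, hkw, hcoe] with p h1 h2 h3 h4
    have h5 : Tendsto (fun i => diffQuot β (u (n (k i))) p) atTop (𝓝 (diffQuot β v p)) :=
      ((h1.comp hk.tendsto_atTop).sub (h2.comp hk.tendsto_atTop)).div_const _
    simp only [Function.comp_apply, h4] at h3
    exact tendsto_nhds_unique h5 h3
  have hmem : v ∈ domain β := mem_domain_iff.2 ((Lp.memLp w).ae_eq heq.symm)
  exact ⟨hmem, Lp.ext ((mem_domain_iff.1 hmem).coeFn_toLp.trans heq)⟩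

/-! ### Closedness, Markov property and regularity. -/

lemma isSymmetricForm {β : ℝ} (hd : Dense (domain β)) : IsSymmetricForm (form β) (domain β) where
  zero_mem := zero_mem_domain β
  add_mem _ hu _ hv := add_mem_domain hu hv
  smul_mem c _ hu := smul_mem_domain c hu
  dense := hd
  symm u hu v hv := by rw [form_eq_inner hu hv, form_eq_inner hv hu, real_inner_comm]
  add_left u hu u' hu' v hv := by
    rw [form_eq_inner (add_mem_domain hu hu') hv, form_eq_inner hu hv, form_eq_inner hu' hv,
      diffQuotLp_add, inner_add_left]
  smul_left c u hu v hv := by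
    rw [form_eq_inner (smul_mem_domain c hu) hv, form_eq_inner hu hv, diffQuotLp_smul,
      real_inner_smul_left]
  nonneg u hu := by
    rw [form_eq_inner hu hu]
    exact real_inner_self_nonneg

lemma isClosedForm {β : ℝ} (hd : Dense (domain β)) : IsClosedForm (form β) (domain β) where
  toIsSymmetricForm := isSymmetricForm hd
  complete u hu hc := by
    have hc' : ∀ ε > 0, ∃ N, ∀ m ≥ N, ∀ n ≥ N,
        dist (diffQuotLp (hu m)) (diffQuotLp (hu n)) < ε ∧ dist (u m) (u n) < ε := by
      intro ε hε
      obtain ⟨N, hN⟩ := hc (ε ^ 2) (by positivity)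
      refine ⟨N, fun m hm n hn => ?_⟩
      have h := hN m hm n hn
      rw [formOne_sub (hu m) (hu n)] at h
      have h1 := sq_nonneg (dist (diffQuotLp (hu m)) (diffQuotLp (hu n)))
      have h2 := sq_nonneg (dist (u m) (u n))
      exact ⟨lt_of_pow_lt_pow_left₀ 2 hε.le (by linarith),
        lt_of_pow_lt_pow_left₀ 2 hε.le (by linarith)⟩
    obtain ⟨v, hv⟩ := cauchySeq_tendsto_of_complete (u := u) (Metric.cauchySeq_iff.2 fun ε hε =>
      (hc' ε hε).imp fun N hN m hm n hn => (hN m hm n hn).2)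
    obtain ⟨w, hw⟩ := cauchySeq_tendsto_of_complete (u := fun n => diffQuotLp (hu n))
      (Metric.cauchySeq_iff.2 fun ε hε =>
        (hc' ε hε).imp fun N hN m hm n hn => (hN m hm n hn).1)
    obtain ⟨hmem, rfl⟩ := exists_diffQuotLp_eq_of_tendsto hu hv hw
    refine ⟨v, hmem, ?_⟩
    simp only [formOne_sub (hu _) hmem]
    simpa using ((tendsto_iff_dist_tendsto_zero.1 hw).pow 2).add
      ((tendsto_iff_dist_tendsto_zero.1 hv).pow 2)

lemma energy_le_of_ae_eq_comp {β : ℝ} {u v : Lp ℝ 2 hausdorffProb} {φ : ℝ → ℝ}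
    (hφ : LipschitzWith 1 φ) (h : v =ᵐ[hausdorffProb] fun x => φ (u x)) :
    energy β v ≤ energy β u := by
  have h1 : energy β v = funEnergy β fun x => φ (u x) := funEnergy_congr h
  rw [h1]
  refine lintegral_mono fun x => lintegral_mono fun y => ENNReal.ofReal_le_ofReal ?_
  have h2 : |φ (u x) - φ (u y)| ≤ |u x - u y| := by
    simpa [Real.dist_eq] using hφ.dist_le_mul (u x) (u y)
  have h3 := sq_le_sq.2 h2
  gcongr

/-- Truncation to `[0, 1]` works for every `ε` at once; being 1-Lipschitz, it does not increase any
difference `|u x - u y|`. -/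
lemma isMarkovian (β : ℝ) : IsMarkovian (form β) (domain β) := by
  intro ε hε
  have hL : LipschitzWith 1 fun t : ℝ => max 0 (min 1 t) :=
    (LipschitzWith.id.const_min 1).const_max 0
  refine ⟨fun t => max 0 (min 1 t), fun t ht => ?_, fun t => ⟨?_, ?_⟩, fun s t hst => ⟨?_, ?_⟩,
    fun u hu => ?_⟩
  · simp only [min_eq_right ht.2, max_eq_right ht.1]
  · exact le_max_of_le_left (by linarith)
  · exact max_le (by linarith) ((min_le_left _ _).trans (by linarith))
  · exact sub_nonneg.2 (max_le_max le_rfl (min_le_min le_rfl hst))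
  · have h := hL.dist_le_mul t s
    rw [NNReal.coe_one, one_mul, Real.dist_eq, Real.dist_eq, abs_of_nonneg (sub_nonneg.2 hst)] at h
    exact (le_abs_self _).trans h
  · have h0 : (fun t : ℝ => max 0 (min 1 t)) 0 = 0 := by simp
    have hv := hL.coeFn_compLp h0 u
    have hle := energy_le_of_ae_eq_comp (β := β) hL hv
    have hmem : hL.compLp h0 u ∈ domain β := lt_of_le_of_lt hle hu
    refine ⟨hL.compLp h0 u, hmem, hv, ?_⟩
    rw [form_self hmem, form_self hu]
    exact ENNReal.toReal_mono hu.ne hle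

/-- Uniform density in `C(K)` passes to `L²`, since `C(K)` maps continuously onto a dense subspace.
-/
lemma dense_domain_of_dense_continuous {β : ℝ}
    (h : ∀ g : carpet → ℝ, Continuous g → ∀ ε : ℝ, 0 < ε → ∃ v ∈ domain β, ∃ f : carpet → ℝ,
      Continuous f ∧ v =ᵐ[hausdorffProb] f ∧ ∀ x, |g x - f x| < ε) :
    Dense (domain β) := by
  have hS : Dense {f : C(carpet, ℝ) | ContinuousMap.toLp 2 hausdorffProb ℝ f ∈ domain β} := by
    refine Metric.dense_iff.2 fun g ε hε => ?_
    obtain ⟨v, hv, f, hf, hvf, hgf⟩ := h g g.continuous ε hε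
    refine ⟨⟨f, hf⟩, ?_, ?_⟩
    · rw [Metric.mem_ball, dist_comm, ContinuousMap.dist_lt_iff hε]
      intro x
      rw [Real.dist_eq]
      exact hgf x
    · have : ContinuousMap.toLp 2 hausdorffProb ℝ ⟨f, hf⟩ = v :=
        Lp.ext ((ContinuousMap.coeFn_toLp hausdorffProb _).trans hvf.symm)
      rwa [Set.mem_ofPred_eq, this]
  refine ((ContinuousMap.toLp_denseRange ℝ hausdorffProb ℝ (by norm_num)).dense_image
    (ContinuousLinearMap.continuous _) hS).mono ?_
  rintro _ ⟨f, hf, rfl⟩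
  exact hf

/-- If all elements of the domain are continuous and the domain is uniformly dense, then the form is
a regular Dirichlet form. -/
lemma isRegularDirichletForm_of {β : ℝ}
    (hc : ∀ u ∈ domain β, ∃ f : carpet → ℝ, Continuous f ∧ u =ᵐ[hausdorffProb] f)
    (h : ∀ g : carpet → ℝ, Continuous g → ∀ ε : ℝ, 0 < ε → ∃ v ∈ domain β, ∃ f : carpet → ℝ,
      Continuous f ∧ v =ᵐ[hausdorffProb] f ∧ ∀ x, |g x - f x| < ε) :
    IsRegularDirichletForm (form β) (domain β) where
  toIsClosedForm := isClosedForm (dense_domain_of_dense_continuous h)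
  markovian := isMarkovian β
  dense_domain u hu ε hε := by
    obtain ⟨f, hf, huf⟩ := hc u hu
    refine ⟨u, hu, ⟨f, hf, HasCompactSupport.of_compactSpace f, huf⟩, ?_⟩
    rw [formOne_sub hu hu, dist_self, dist_self]
    simpa using hε
  dense_continuous g hg _ ε hε := by
    obtain ⟨v, hv, f, hf, hvf, hgf⟩ := h g hg ε hε
    exact ⟨v, hv, f, hf, HasCompactSupport.of_compactSpace f, hvf, hgf⟩

end SierpinskiCarpet

namespace SierpinskiCarpet

/-! ### Averages of functions of finite energy -/

/-- Jensen's inequality for `t ↦ (t - c)²`. -/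
lemma ofReal_sq_average_sub_le {u : carpet → ℝ} (hu : MemLp u 2 hausdorffProb) {A : Set carpet}
    (hA : hausdorffProb A ≠ 0) (c : ℝ) :
    ENNReal.ofReal ((⨍ y in A, u y ∂hausdorffProb - c) ^ 2) ≤
      (∫⁻ y in A, ENNReal.ofReal ((u y - c) ^ 2) ∂hausdorffProb) / hausdorffProb A := by
  have hint : Integrable u hausdorffProb := hu.integrable (by norm_num)
  have hsq : Integrable (fun y => (u y - c) ^ 2) hausdorffProb := (hu.sub (memLp_const c)).integrable_sq
  have hconv : ConvexOn ℝ Set.univ fun t : ℝ => (t - c) ^ 2 := by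
    have := (even_two.convexOn_pow (𝕜 := ℝ)).translate_left (-c)
    simpa [Function.comp_def, sub_eq_add_neg] using this
  have h := hconv.map_set_average_le (f := u) (by fun_prop) isClosed_univ hA (measure_ne_top _ _)
    (Eventually.of_forall fun _ => Set.mem_univ _) hint.integrableOn hsq.integrableOn
  refine (ENNReal.ofReal_le_ofReal h).trans_eq ?_
  exact ofReal_setAverage hsq.integrableOn (Eventually.of_forall fun _ => sq_nonneg _)

/-- The part of the energy that comes from the pairs in `A × B`. -/
noncomputable def pairEnergy (β : ℝ) (u : carpet → ℝ) (A B : Set carpet) : ENNReal :=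
  ∫⁻ x in A, ∫⁻ y in B, ENNReal.ofReal ((u x - u y) ^ 2 / dist x y ^ (hausdorffDim + β))
    ∂hausdorffProb ∂hausdorffProb

lemma sq_sub_le_mul_div {s D : ℝ} (hs : 0 ≤ s) {u : carpet → ℝ} {x y : carpet}
    (h : dist x y ≤ D) : (u x - u y) ^ 2 ≤ D ^ s * ((u x - u y) ^ 2 / dist x y ^ s) := by
  rcases eq_or_ne x y with rfl | hne
  · simp
  have hpos : 0 < dist x y ^ s := Real.rpow_pos_of_pos (dist_pos.2 hne) s
  rw [← mul_div_assoc, le_div_iff₀ hpos, mul_comm]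
  gcongr

lemma setLIntegral_sq_sub_le {s D : ℝ} (hs : 0 ≤ s) (hD : 0 ≤ D) (u : carpet → ℝ) (x : carpet)
    {B : Set carpet} (hB : MeasurableSet B) (h : ∀ y ∈ B, dist x y ≤ D) :
    ∫⁻ y in B, ENNReal.ofReal ((u x - u y) ^ 2) ∂hausdorffProb ≤ ENNReal.ofReal (D ^ s) *
      ∫⁻ y in B, ENNReal.ofReal ((u x - u y) ^ 2 / dist x y ^ s) ∂hausdorffProb := by
  rw [← lintegral_const_mul' _ _ ENNReal.ofReal_ne_top]
  refine setLIntegral_mono' hB fun y hy => ?_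
  rw [← ENNReal.ofReal_mul (by positivity)]
  exact ENNReal.ofReal_le_ofReal (sq_sub_le_mul_div hs (h y hy))

/-- Jensen is applied once for each average; on `A × B` the kernel `|x - y|^(-(α+β))` is at least
`D^(-(α+β))`. -/
lemma ofReal_sq_average_sub_average_le {β D : ℝ} (hβ : 0 ≤ β) (hD : 0 ≤ D) {u : carpet → ℝ}
    (hu : MemLp u 2 hausdorffProb) {A B : Set carpet} (hA : MeasurableSet A) (hB : MeasurableSet B)
    (hA0 : hausdorffProb A ≠ 0) (hB0 : hausdorffProb B ≠ 0)
    (h : ∀ x ∈ A, ∀ y ∈ B, dist x y ≤ D) :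
    ENNReal.ofReal ((⨍ y in A, u y ∂hausdorffProb - ⨍ y in B, u y ∂hausdorffProb) ^ 2) ≤
      (hausdorffProb A)⁻¹ * (hausdorffProb B)⁻¹ * ENNReal.ofReal (D ^ (hausdorffDim + β)) *
        pairEnergy β u A B := by
  have hs : 0 ≤ hausdorffDim + β := add_nonneg hausdorffDim_pos.le hβ
  have hB1 : (hausdorffProb B)⁻¹ ≠ ⊤ := ENNReal.inv_ne_top.2 hB0
  refine (ofReal_sq_average_sub_le hu hA0 _).trans ?_
  rw [ENNReal.div_eq_inv_mul, mul_assoc, mul_assoc]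
  gcongr
  rw [pairEnergy, ← lintegral_const_mul' _ _ ENNReal.ofReal_ne_top, ← lintegral_const_mul' _ _ hB1]
  refine setLIntegral_mono' hA fun x hx => ?_
  rw [← neg_sub, neg_sq]
  refine (ofReal_sq_average_sub_le hu hB0 _).trans ?_
  rw [ENNReal.div_eq_inv_mul]
  gcongr
  simp only [← neg_sub (u x), neg_sq]
  exact setLIntegral_sq_sub_le hs hD u x hB (h x hx)

lemma pairEnergy_le (β : ℝ) (u : carpet → ℝ) (A B : Set carpet) :
    pairEnergy β u A B ≤ funEnergy β u :=
  (setLIntegral_le_lintegral _ _).trans (lintegral_mono fun _ => setLIntegral_le_lintegral _ _)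

lemma inv_le_of_one_le_mul {a b : ENNReal} (h : 1 ≤ b * a) : a⁻¹ ≤ b := by
  rw [ENNReal.inv_le_iff_le_mul] <;> first | simpa [mul_comm] using h | skip
  · intro hb; rintro rfl; simp at h
  · intro hb; rintro rfl; simp at h

lemma ne_zero_of_one_le_mul {a b : ENNReal} (h : 1 ≤ b * a) : a ≠ 0 := by
  rintro rfl
  simp at h

/-! ### Continuity of functions of finite energy -/

/-- The `a n` converge uniformly at a geometric rate, and the oscillation of `a n` at scale `r n` is
of the same order. The `a n` themselves need not be continuous. -/
lemma exists_continuous_limit {X : Type*} [PseudoMetricSpace X] {a : ℕ → X → ℝ} {C θ : ℝ}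
    {r : ℕ → ℝ} (hr : ∀ n, 0 < r n) (hθ0 : 0 ≤ θ) (hθ : θ < 1)
    (h1 : ∀ n x, |a n x - a (n + 1) x| ≤ C * θ ^ n)
    (h2 : ∀ n x y, dist x y ≤ r n → |a n x - a n y| ≤ C * θ ^ n) :
    ∃ f : X → ℝ, Continuous f ∧ ∀ x, Tendsto (fun n => a n x) atTop (𝓝 (f x)) := by
  have hd : ∀ x n, dist (a n x) (a (n + 1) x) ≤ C * θ ^ n := fun x n => h1 n x
  choose f hf using fun x => cauchySeq_tendsto_of_complete (cauchySeq_of_le_geometric θ C hθ (hd x))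
  refine ⟨f, ?_, hf⟩
  have hlim : ∀ x n, dist (a n x) (f x) ≤ C * θ ^ n / (1 - θ) := fun x n =>
    dist_le_of_le_geometric_of_tendsto θ C hθ (hd x) (hf x) n
  have hsmall : Tendsto (fun n : ℕ => (2 * C / (1 - θ) + C) * θ ^ n) atTop (𝓝 0) := by
    simpa using (tendsto_pow_atTop_nhds_zero_of_lt_one hθ0 hθ).const_mul (2 * C / (1 - θ) + C)
  refine Metric.continuous_iff.2 fun x ε hε => ?_
  obtain ⟨n, hn⟩ := (hsmall.eventually (gt_mem_nhds hε)).exists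
  refine ⟨r n, hr n, fun y hy => lt_of_le_of_lt ?_ hn⟩
  calc dist (f y) (f x) ≤ dist (f y) (a n y) + dist (a n y) (a n x) + dist (a n x) (f x) :=
        dist_triangle4 _ _ _ _
    _ ≤ C * θ ^ n / (1 - θ) + C * θ ^ n + C * θ ^ n / (1 - θ) := by
        gcongr
        · rw [dist_comm]; exact hlim y n
        · exact h2 n y x hy.le
        · exact hlim x n
    _ = _ := by ring

/-- The ball with centre `x` and radius `2 * 3⁻ⁿ`. -/
def triadicBall (n : ℕ) (x : carpet) : Set carpet := Metric.closedBall x (2 * (1 / 3) ^ n)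

lemma measurableSet_triadicBall (n : ℕ) (x : carpet) : MeasurableSet (triadicBall n x) :=
  Metric.isClosed_closedBall.measurableSet

lemma one_le_measure_triadicBall (n : ℕ) (x : carpet) :
    1 ≤ 8 ^ n * hausdorffProb (triadicBall n x) :=
  isSelfSimilar_hausdorffProb.le_measure_closedBall n x

/-- Since `3^(-α) = 1/8`, the factor `8ⁿ` cancels the `α` part of the power. -/
lemma eight_pow_mul_rpow (β c : ℝ) (hc : 0 ≤ c) (n : ℕ) :
    8 ^ n * (c * (1 / 3) ^ n) ^ (hausdorffDim + β) =
      c ^ (hausdorffDim + β) * (1 / (3 : ℝ) ^ β) ^ n := by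
  have h2 : ((1 / 3 : ℝ) ^ n) ^ β = (1 / (3 : ℝ) ^ β) ^ n := by
    rw [← Real.rpow_natCast, ← Real.rpow_mul (by norm_num), mul_comm, Real.rpow_mul (by norm_num),
      Real.div_rpow (by norm_num) (by norm_num), Real.one_rpow, Real.rpow_natCast]
  rw [Real.mul_rpow hc (by positivity), Real.rpow_add (x := (1 / 3 : ℝ) ^ n) (by positivity),
    third_rpow_hausdorffDim, h2, mul_left_comm, ← mul_assoc (8 ^ n), ← mul_pow]
  norm_num

/-- Squared, the difference is at most a constant times `8²ⁿ · 3^(-n(α+β)) = (8 / 3^β)ⁿ`. The cases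
`m = n + 1` and `m = n` supply the two hypotheses of `exists_continuous_limit`. -/
lemma abs_average_sub_average_le {β : ℝ} (hβ : 0 ≤ β) {u : carpet → ℝ}
    (hu : MemLp u 2 hausdorffProb) (hE : funEnergy β u < ⊤) {n m : ℕ} (hmn : m ≤ n + 1)
    (hnm : n ≤ m) {x y : carpet} (hxy : dist x y ≤ 2 * (1 / 3) ^ n) :
    |⨍ z in triadicBall n x, u z ∂hausdorffProb - ⨍ z in triadicBall m y, u z ∂hausdorffProb| ≤
      √(8 * 6 ^ (hausdorffDim + β) * (funEnergy β u).toReal) * √(8 / (3 : ℝ) ^ β) ^ n := by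
  have hD : ∀ z ∈ triadicBall n x, ∀ w ∈ triadicBall m y, dist z w ≤ 6 * (1 / 3) ^ n := by
    intro z hz w hw
    have h1 : dist z x ≤ 2 * (1 / 3) ^ n := hz
    have h2 : dist w y ≤ 2 * (1 / 3) ^ m := hw
    have h3 : (1 / 3 : ℝ) ^ m ≤ (1 / 3) ^ n := pow_le_pow_of_le_one (by norm_num) (by norm_num) hnm
    have h4 := dist_triangle4 z x y w
    rw [dist_comm y w] at h4
    linarith
  have hA := one_le_measure_triadicBall n x
  have hB := one_le_measure_triadicBall m y
  have h := ofReal_sq_average_sub_average_le hβ (by positivity) hu (measurableSet_triadicBall n x)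
    (measurableSet_triadicBall m y) (ne_zero_of_one_le_mul hA) (ne_zero_of_one_le_mul hB) hD
  have h' := h.trans (show _ ≤ 8 ^ n * 8 ^ (n + 1) *
      ENNReal.ofReal ((6 * (1 / 3) ^ n) ^ (hausdorffDim + β)) * funEnergy β u by
    gcongr
    · exact inv_le_of_one_le_mul hA
    · exact (inv_le_of_one_le_mul hB).trans (pow_le_pow_right₀ (by norm_num) hmn)
    · exact pairEnergy_le _ _ _ _)
  have h8 : (8 : ENNReal) = ENNReal.ofReal 8 := by simp
  rw [← ENNReal.ofReal_toReal hE.ne, h8, ← ENNReal.ofReal_pow (by norm_num),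
    ← ENNReal.ofReal_pow (by norm_num), ← ENNReal.ofReal_mul (by positivity),
    ← ENNReal.ofReal_mul (by positivity), ← ENNReal.ofReal_mul (by positivity),
    ENNReal.ofReal_le_ofReal_iff (by positivity)] at h'
  refine abs_le_of_sq_le_sq (h'.trans_eq ?_) (by positivity)
  rw [mul_pow, ← pow_mul, mul_comm n 2, pow_mul, Real.sq_sqrt (by positivity),
    Real.sq_sqrt (by positivity)]
  have key := eight_pow_mul_rpow β 6 (by norm_num) n
  calc _ = 8 ^ n * 8 * (8 ^ n * (6 * (1 / 3) ^ n) ^ (hausdorffDim + β)) *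
        (funEnergy β u).toReal := by ring
    _ = _ := by
      rw [key, div_pow, div_pow, one_pow]
      ring

/-- At almost every `x` the inner energy integral is finite, and Jensen then bounds the squared
deviation of the average from `u x` by a multiple of `3^(-βn)`. Finite energy thus replaces a
differentiation theorem. -/
lemma ae_tendsto_average {β : ℝ} (hβ : 0 < β) {u : Lp ℝ 2 hausdorffProb} (hE : u ∈ domain β) :
    ∀ᵐ x ∂hausdorffProb,
      Tendsto (fun n => ⨍ z in triadicBall n x, u z ∂hausdorffProb) atTop (𝓝 (u x)) := by
  have hs : 0 ≤ hausdorffDim + β := add_nonneg hausdorffDim_pos.le hβ.le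
  have hm := Lp.stronglyMeasurable u
  have hmeas : Measurable fun p : carpet × carpet =>
      ENNReal.ofReal ((u p.1 - u p.2) ^ 2 / dist p.1 p.2 ^ (hausdorffDim + β)) :=
    ((((hm.measurable.comp measurable_fst).sub (hm.measurable.comp measurable_snd)).pow_const 2).div
      (measurable_dist.pow_const _)).ennreal_ofReal
  filter_upwards [ae_lt_top hmeas.lintegral_prod_right' (ne_of_lt hE)] with x hx
  set e := ∫⁻ y, ENNReal.ofReal ((u x - u y) ^ 2 / dist x y ^ (hausdorffDim + β)) ∂hausdorffProb
  have hbound : ∀ n, (⨍ z in triadicBall n x, u z ∂hausdorffProb - u x) ^ 2 ≤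
      2 ^ (hausdorffDim + β) * e.toReal * (1 / (3 : ℝ) ^ β) ^ n := by
    intro n
    have hA := one_le_measure_triadicBall n x
    have h := ofReal_sq_average_sub_le (Lp.memLp u) (ne_zero_of_one_le_mul hA) (u x)
    rw [ENNReal.div_eq_inv_mul] at h
    have h' := h.trans (show _ ≤
        8 ^ n * (ENNReal.ofReal ((2 * (1 / 3) ^ n) ^ (hausdorffDim + β)) * e) by
      gcongr
      · exact inv_le_of_one_le_mul hA
      · simp only [← neg_sub (u x), neg_sq]
        refine (setLIntegral_sq_sub_le hs (by positivity) u x (measurableSet_triadicBall n x)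
          fun y hy => ?_).trans (mul_le_mul_right (setLIntegral_le_lintegral _ _) _)
        rw [dist_comm]
        exact hy)
    have h8 : (8 : ENNReal) = ENNReal.ofReal 8 := by simp
    rw [← ENNReal.ofReal_toReal hx.ne, h8, ← ENNReal.ofReal_pow (by norm_num),
      ← ENNReal.ofReal_mul (by positivity), ← ENNReal.ofReal_mul (by positivity),
      ENNReal.ofReal_le_ofReal_iff (by positivity), ← mul_assoc,
      eight_pow_mul_rpow β 2 (by norm_num) n] at h'
    linarith
  have h3 : 1 / (3 : ℝ) ^ β < 1 := by
    rw [div_lt_one (by positivity)]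
    exact Real.one_lt_rpow (by norm_num) hβ
  have hlim : Tendsto (fun n : ℕ => 2 ^ (hausdorffDim + β) * e.toReal * (1 / (3 : ℝ) ^ β) ^ n)
      atTop (𝓝 0) := by
    simpa using (tendsto_pow_atTop_nhds_zero_of_lt_one (by positivity) h3).const_mul
      (2 ^ (hausdorffDim + β) * e.toReal)
  have hsq := squeeze_zero (fun n => sq_nonneg _) hbound hlim
  have habs : Tendsto (fun n => |⨍ z in triadicBall n x, u z ∂hausdorffProb - u x|) atTop (𝓝 0) := by
    have := hsq.sqrt
    simpa only [Real.sqrt_sq_eq_abs, Real.sqrt_zero] using this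
  exact tendsto_sub_nhds_zero_iff.1 ((tendsto_zero_iff_abs_tendsto_zero _).2 habs)

/-- For `β > α`, functions of finite energy are continuous. -/
lemma exists_continuous_ae_eq {β : ℝ} (hβ : hausdorffDim < β) {u : Lp ℝ 2 hausdorffProb}
    (hu : u ∈ domain β) : ∃ f : carpet → ℝ, Continuous f ∧ u =ᵐ[hausdorffProb] f := by
  have hβ0 : 0 < β := hausdorffDim_pos.trans hβ
  -- This is where `β > α` enters, as `8 = 3^α`.
  have hθ : √(8 / (3 : ℝ) ^ β) < 1 := by
    rw [Real.sqrt_lt' one_pos, one_pow, div_lt_one (by positivity), ← three_rpow_hausdorffDim]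
    exact Real.rpow_lt_rpow_of_exponent_lt (by norm_num) hβ
  obtain ⟨f, hf, hlim⟩ := exists_continuous_limit
    (a := fun n x => ⨍ z in triadicBall n x, u z ∂hausdorffProb) (r := fun n => 2 * (1 / 3) ^ n)
    (fun n => by positivity) (Real.sqrt_nonneg _) hθ
    (fun n x => abs_average_sub_average_le hβ0.le (Lp.memLp u) hu le_rfl n.le_succ
      (by rw [dist_self]; positivity))
    (fun n x y hxy => abs_average_sub_average_le hβ0.le (Lp.memLp u) hu n.le_succ le_rfl hxy)
  refine ⟨f, hf, ?_⟩
  filter_upwards [ae_tendsto_average hβ0 hu] with x hx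
  exact tendsto_nhds_unique hx (hlim x)

/-! ### The upper bound -/

/-- Each `B i` is enlarged to the whole carpet, so only the `A i` have to be disjoint. -/
lemma sum_pairEnergy_le (β : ℝ) (u : carpet → ℝ) {ι : Type*} (s : Finset ι) (A B : ι → Set carpet)
    (hA : ∀ i ∈ s, MeasurableSet (A i)) (hd : Set.PairwiseDisjoint (s : Set ι) A) :
    ∑ i ∈ s, pairEnergy β u (A i) (B i) ≤ funEnergy β u := by
  calc ∑ i ∈ s, pairEnergy β u (A i) (B i)
      ≤ ∑ i ∈ s, pairEnergy β u (A i) Set.univ :=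
        Finset.sum_le_sum fun i _ => lintegral_mono fun x =>
          lintegral_mono' (Measure.restrict_mono (Set.subset_univ _) le_rfl) le_rfl
    _ = pairEnergy β u (⋃ i ∈ s, A i) Set.univ := (lintegral_biUnion_finset hd hA _).symm
    _ ≤ _ := pairEnergy_le _ _ _ _

/-- The average of `u` over a square of side `3⁻ⁿ`. -/
noncomputable def squareAverage (u : carpet → ℝ) (n i b : ℕ) : ℝ :=
  ⨍ y in gridSquare n ![i, b], u y ∂hausdorffProb

lemma dist_le_of_mem_gridSquare {n i b : ℕ} {x y : carpet} (hx : x ∈ gridSquare n ![i, b])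
    (hy : y ∈ gridSquare n ![i + 1, b]) : dist x y ≤ 3 * (1 / 3) ^ n := by
  have hx0 := coord_bounds_of_gridIndex n 0 x
  have hx1 := coord_bounds_of_gridIndex n 1 x
  have hy0 := coord_bounds_of_gridIndex n 0 y
  have hy1 := coord_bounds_of_gridIndex n 1 y
  rw [hx 0] at hx0
  rw [hx 1] at hx1
  rw [hy 0] at hy0
  rw [hy 1] at hy1
  simp only [Matrix.cons_val_zero, Matrix.cons_val_one, Nat.cast_add, Nat.cast_one] at hx0 hx1 hy0 hy1
  have h0 : |x.1 0 - y.1 0| ≤ 2 * (1 / 3) ^ n := abs_le.2 ⟨by nlinarith, by nlinarith⟩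
  have h1 : |x.1 1 - y.1 1| ≤ (1 / 3) ^ n := abs_le.2 ⟨by nlinarith, by nlinarith⟩
  linarith [dist_le_add x y]

lemma ofReal_sq_squareAverage_sub_le {β : ℝ} (hβ : 0 ≤ β) {u : carpet → ℝ}
    (hu : MemLp u 2 hausdorffProb) {n i b : ℕ} (hi : i + 1 < 3 ^ n) (hb : b ∈ cantorRows n) :
    ENNReal.ofReal ((squareAverage u n (i + 1) b - squareAverage u n i b) ^ 2) ≤
      8 ^ n * 8 ^ n * ENNReal.ofReal ((3 * (1 / 3) ^ n) ^ (hausdorffDim + β)) *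
        pairEnergy β u (gridSquare n ![i, b]) (gridSquare n ![i + 1, b]) := by
  have hA := isSelfSimilar_hausdorffProb.le_measure_gridSquare_cantorRows
    (show i < 3 ^ n by omega) hb
  have hB := isSelfSimilar_hausdorffProb.le_measure_gridSquare_cantorRows hi hb
  rw [← neg_sub, neg_sq]
  refine (ofReal_sq_average_sub_average_le hβ (by positivity) hu (measurableSet_gridSquare _ _)
    (measurableSet_gridSquare _ _) (ne_zero_of_one_le_mul hA) (ne_zero_of_one_le_mul hB)
    fun x hx y hy => dist_le_of_mem_gridSquare hx hy).trans ?_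
  gcongr
  · exact inv_le_of_one_le_mul hA
  · exact inv_le_of_one_le_mul hB

/-- Neighbouring squares of a Cantor row have mass at least `8⁻ⁿ` each, and the left squares of all
pairs are disjoint; so the total is controlled by one copy of the energy. -/
lemma sum_sq_squareAverage_sub_le {β : ℝ} (hβ : 0 ≤ β) {u : carpet → ℝ}
    (hu : MemLp u 2 hausdorffProb) (hE : funEnergy β u < ⊤) (n : ℕ) :
    ∑ b ∈ cantorRows n, ∑ i ∈ Finset.range (3 ^ n - 1),
      (squareAverage u n (i + 1) b - squareAverage u n i b) ^ 2 ≤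
        3 ^ (hausdorffDim + β) * (funEnergy β u).toReal * (8 / (3 : ℝ) ^ β) ^ n := by
  have h := calc
    ENNReal.ofReal (∑ b ∈ cantorRows n, ∑ i ∈ Finset.range (3 ^ n - 1),
      (squareAverage u n (i + 1) b - squareAverage u n i b) ^ 2)
    _ = ∑ p ∈ cantorRows n ×ˢ Finset.range (3 ^ n - 1),
        ENNReal.ofReal ((squareAverage u n (p.2 + 1) p.1 - squareAverage u n p.2 p.1) ^ 2) := by
      rw [← Finset.sum_product', ENNReal.ofReal_sum_of_nonneg fun p _ => sq_nonneg _]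
    _ ≤ ∑ p ∈ cantorRows n ×ˢ Finset.range (3 ^ n - 1),
        8 ^ n * 8 ^ n * ENNReal.ofReal ((3 * (1 / 3) ^ n) ^ (hausdorffDim + β)) *
          pairEnergy β u (gridSquare n ![p.2, p.1]) (gridSquare n ![p.2 + 1, p.1]) := by
      refine Finset.sum_le_sum fun p hp => ?_
      rw [Finset.mem_product, Finset.mem_range] at hp
      exact ofReal_sq_squareAverage_sub_le hβ hu (by omega) hp.1
    _ ≤ 8 ^ n * 8 ^ n * ENNReal.ofReal ((3 * (1 / 3) ^ n) ^ (hausdorffDim + β)) *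
        funEnergy β u := by
      rw [← Finset.mul_sum]
      gcongr
      refine sum_pairEnergy_le β u _ _ _ (fun _ _ => measurableSet_gridSquare _ _) ?_
      intro p _ q _ hpq
      refine Set.disjoint_left.2 fun x hx hy => hpq ?_
      have h0 := (hx 0).symm.trans (hy 0)
      have h1 := (hx 1).symm.trans (hy 1)
      exact Prod.ext h1 h0
  have h8 : (8 : ENNReal) = ENNReal.ofReal 8 := by simp
  rw [← ENNReal.ofReal_toReal hE.ne, h8, ← ENNReal.ofReal_pow (by norm_num),
    ← ENNReal.ofReal_mul (by positivity), ← ENNReal.ofReal_mul (by positivity),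
    ← ENNReal.ofReal_mul (by positivity), ENNReal.ofReal_le_ofReal_iff (by positivity)] at h
  refine h.trans_eq ?_
  rw [mul_assoc (8 ^ n), eight_pow_mul_rpow β 3 (by norm_num), div_pow, div_pow, one_pow]
  ring

lemma squareAverage_mem {u : carpet → ℝ} (hu : MemLp u 2 hausdorffProb) {s : Set ℝ}
    (hs : Convex ℝ s) (hc : IsClosed s) {n i b : ℕ} (hi : i < 3 ^ n) (hb : b ∈ cantorRows n)
    (h : ∀ᵐ x ∂hausdorffProb, x ∈ gridSquare n ![i, b] → u x ∈ s) : squareAverage u n i b ∈ s :=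
  hs.set_average_mem hc
    (ne_zero_of_one_le_mul (isSelfSimilar_hausdorffProb.le_measure_gridSquare_cantorRows hi hb))
    (measure_ne_top _ _) ((ae_restrict_iff' (measurableSet_gridSquare _ _)).2 h)
    (hu.integrable (by norm_num)).integrableOn

/-- A function of finite energy cannot be close to the first coordinate if `3 ^ β > 12`. -/
lemma three_rpow_le_of_approx {β : ℝ} (hβ : 0 ≤ β) {u : carpet → ℝ}
    (hu : MemLp u 2 hausdorffProb) (hE : funEnergy β u < ⊤)
    (happ : ∀ᵐ x ∂hausdorffProb, |x.1 0 - u x| ≤ 1 / 4) : (3 : ℝ) ^ β ≤ 12 := by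
  by_contra! hlt
  set C := 3 ^ (hausdorffDim + β) * (funEnergy β u).toReal with hC
  -- Telescoping and Cauchy–Schwarz along one row. For `n ≥ 2` the end averages differ by at least
  -- `1 - 2/9 - 1/2 ≥ 1/4`, whence `1/16`.
  have hrow : ∀ n ≥ 2, ∀ b ∈ cantorRows n, 1 / 16 ≤ 3 ^ n *
      ∑ i ∈ Finset.range (3 ^ n - 1),
        (squareAverage u n (i + 1) b - squareAverage u n i b) ^ 2 := by
    intro n hn b hb
    have hpos : 0 < 3 ^ n := by positivity
    have hsmall : (1 / 3 : ℝ) ^ n ≤ 1 / 9 := by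
      calc (1 / 3 : ℝ) ^ n ≤ (1 / 3) ^ 2 := pow_le_pow_of_le_one (by norm_num) (by norm_num) hn
        _ = 1 / 9 := by norm_num
    have h3 : (3 : ℝ) ^ n * (1 / 3) ^ n = 1 := by rw [← mul_pow]; norm_num
    have hl : squareAverage u n 0 b ≤ (1 / 3) ^ n + 1 / 4 := by
      refine squareAverage_mem hu (convex_Iic _) isClosed_Iic hpos hb ?_
      filter_upwards [happ] with x hx hmem
      have h0 := coord_bounds_of_gridIndex n 0 x
      rw [hmem 0] at h0
      simp only [Matrix.cons_val_zero, Nat.cast_zero] at h0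
      rw [Set.mem_Iic]
      linarith [(abs_le.1 hx).1]
    have hr : 1 - (1 / 3) ^ n - 1 / 4 ≤ squareAverage u n (3 ^ n - 1) b := by
      refine squareAverage_mem hu (convex_Ici _) isClosed_Ici (by omega) hb ?_
      filter_upwards [happ] with x hx hmem
      have h0 := coord_bounds_of_gridIndex n 0 x
      rw [hmem 0] at h0
      simp only [Matrix.cons_val_zero, Nat.cast_sub (show 1 ≤ 3 ^ n from hpos), Nat.cast_pow,
        Nat.cast_ofNat, Nat.cast_one, sub_mul, h3] at h0
      rw [Set.mem_Ici]
      linarith [(abs_le.1 hx).2]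
    have htel := Finset.sum_range_sub (fun i => squareAverage u n i b) (3 ^ n - 1)
    have hcs := sq_sum_le_card_mul_sum_sq (s := Finset.range (3 ^ n - 1))
      (f := fun i => squareAverage u n (i + 1) b - squareAverage u n i b)
    rw [htel, Finset.card_range, Nat.cast_sub (show 1 ≤ 3 ^ n from hpos)] at hcs
    push_cast at hcs
    have hsum : 0 ≤ ∑ i ∈ Finset.range (3 ^ n - 1),
        (squareAverage u n (i + 1) b - squareAverage u n i b) ^ 2 :=
      Finset.sum_nonneg fun _ _ => sq_nonneg _
    have hdiff : 1 / 4 ≤ squareAverage u n (3 ^ n - 1) b - squareAverage u n 0 b := by linarith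
    nlinarith
  -- Summing over the `2ⁿ` rows gives `2ⁿ / 16 ≤ C (24 / 3^β)ⁿ`; dividing by `2ⁿ` produces the `12`.
  have hmain : ∀ n ≥ 2, 1 / 16 ≤ C * (12 / (3 : ℝ) ^ β) ^ n := by
    intro n hn
    have h1 := Finset.sum_le_sum (hrow n hn)
    rw [Finset.sum_const, card_cantorRows, ← Finset.mul_sum, nsmul_eq_mul] at h1
    push_cast at h1
    have h2 := sum_sq_squareAverage_sub_le hβ hu hE n
    have h3 : (2 : ℝ) ^ n * (1 / 16) ≤ 3 ^ n * (C * (8 / (3 : ℝ) ^ β) ^ n) := by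
      refine h1.trans ?_
      gcongr
    have h4 : (12 / (3 : ℝ) ^ β) ^ n * 2 ^ n = 3 ^ n * (8 / (3 : ℝ) ^ β) ^ n := by
      rw [← mul_pow, ← mul_pow]
      congr 1
      ring
    have h5 : (0 : ℝ) < 2 ^ n := by positivity
    have h6 : 1 / 16 * (2 : ℝ) ^ n ≤ C * (12 / (3 : ℝ) ^ β) ^ n * 2 ^ n := by
      rw [mul_assoc C, h4]
      linarith
    exact le_of_mul_le_mul_right h6 h5
  have hlim : Tendsto (fun n : ℕ => C * (12 / (3 : ℝ) ^ β) ^ n) atTop (𝓝 0) := by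
    simpa using (tendsto_pow_atTop_nhds_zero_of_lt_one (by positivity)
      ((div_lt_one (by positivity)).2 hlt)).const_mul C
  have := ge_of_tendsto hlim (eventually_atTop.2 ⟨2, hmain⟩)
  norm_num at this

lemma le_of_mem_regularIndices {β : ℝ} (hβ : β ∈ regularIndices) :
    β ≤ Real.log (8 * (3 / 2)) / Real.log 3 := by
  obtain ⟨hpos, hreg⟩ := hβ
  obtain ⟨v, hv, f, -, -, hvf, hf⟩ := hreg.dense_continuous (fun x => x.1 0) (continuous_coord 0)
    (HasCompactSupport.of_compactSpace _) (1 / 4) (by norm_num)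
  have h := three_rpow_le_of_approx hpos.le (Lp.memLp v) hv (by
    filter_upwards [hvf] with x hx
    rw [hx]
    exact (hf x).le)
  rw [le_div_iff₀ (Real.log_pos (by norm_num)), ← Real.log_rpow (by norm_num)]
  exact Real.log_le_log (by positivity) (h.trans (by norm_num))

end SierpinskiCarpet

namespace SierpinskiCarpet

/-! ### A singular distribution function -/

/-- The weights of the three columns of the carpet. -/
noncomputable def columnWeight (d : ℕ) : ℝ := if d = 1 then 3 / 7 else 2 / 7

/-- The mass of the `k`-th triadic interval of length `3⁻ⁿ` for the self-similar measure on `[0, ∞)`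
with weights `2/7, 3/7, 2/7` on the first level. -/
noncomputable def weight : ℕ → ℕ → ℝ
  | 0, _ => 1
  | n + 1, k => weight n (k / 3) * columnWeight (k % 3)

lemma columnWeight_pos (d : ℕ) : 0 < columnWeight d := by
  unfold columnWeight; split_ifs <;> norm_num

lemma columnWeight_le (d : ℕ) : columnWeight d ≤ 3 / 7 := by
  unfold columnWeight; split_ifs <;> norm_num

lemma weight_pos (n k : ℕ) : 0 < weight n k := by
  induction n generalizing k with
  | zero => exact one_pos
  | succ n ih => exact mul_pos (ih _) (columnWeight_pos _)

lemma weight_le (n k : ℕ) : weight n k ≤ (3 / 7) ^ n := by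
  induction n generalizing k with
  | zero => simp [weight]
  | succ n ih =>
    rw [weight, pow_succ]
    exact mul_le_mul (ih _) (columnWeight_le _) (columnWeight_pos _).le (by positivity)

lemma weight_three_mul (n k : ℕ) : weight (n + 1) (3 * k) = weight n k * (2 / 7) := by
  rw [weight, show 3 * k / 3 = k by omega, show 3 * k % 3 = 0 by omega]
  simp [columnWeight]

lemma weight_three_mul_add_one (n k : ℕ) : weight (n + 1) (3 * k + 1) = weight n k * (3 / 7) := by
  rw [weight, show (3 * k + 1) / 3 = k by omega, show (3 * k + 1) % 3 = 1 by omega]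
  simp [columnWeight]

lemma weight_three_mul_add_two (n k : ℕ) : weight (n + 1) (3 * k + 2) = weight n k * (2 / 7) := by
  rw [weight, show (3 * k + 2) / 3 = k by omega, show (3 * k + 2) % 3 = 2 by omega]
  simp [columnWeight]

/-- Neighbours with the same parent have ratio `2 : 3`. Across two parents the outer weights are
equal, so the ratio is that of the parents. -/
lemma weight_neighbours (n k : ℕ) :
    weight n (k + 1) ≤ 3 / 2 * weight n k ∧ weight n k ≤ 3 / 2 * weight n (k + 1) := by
  induction n generalizing k with
  | zero => norm_num [weight]
  | succ n ih =>
    obtain ⟨j, hj⟩ : ∃ j, k = 3 * j ∨ k = 3 * j + 1 ∨ k = 3 * j + 2 := ⟨k / 3, by omega⟩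
    have hp := weight_pos n j
    rcases hj with rfl | rfl | rfl
    · rw [weight_three_mul, weight_three_mul_add_one]
      constructor <;> linarith
    · rw [weight_three_mul_add_two, weight_three_mul_add_one]
      constructor <;> linarith
    · rw [weight_three_mul_add_two, show 3 * j + 2 + 1 = 3 * (j + 1) by ring, weight_three_mul]
      have h := ih j
      constructor <;> linarith [h.1, h.2]

/-- The definition of `weight` strips the last triadic digit; this strips the leading one, which is
what `gridIndex_cellMap` adds. -/
lemma weight_add_mul (n : ℕ) {k d : ℕ} (hk : k < 3 ^ n) (hd : d ≤ 2) :
    weight (n + 1) (k + 3 ^ n * d) = weight n k * columnWeight d := by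
  induction n generalizing k with
  | zero =>
    have h0 : k = 0 := by simpa using hk
    simp only [h0, weight, zero_add, pow_zero, one_mul, Nat.mod_eq_of_lt (show d < 3 by omega)]
  | succ n ih =>
    have h1 : (k + 3 ^ (n + 1) * d) / 3 = k / 3 + 3 ^ n * d := by
      rw [pow_succ', mul_assoc]; omega
    have h2 : (k + 3 ^ (n + 1) * d) % 3 = k % 3 := by
      rw [pow_succ', mul_assoc]; omega
    rw [weight, h1, h2, ih (by rw [pow_succ] at hk; omega), weight]
    ring

/-- The mass of the first `k` triadic intervals of length `3⁻ⁿ`. -/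
noncomputable def cumulWeight (n k : ℕ) : ℝ := ∑ i ∈ Finset.range k, weight n i

lemma cumulWeight_mono (n : ℕ) : Monotone (cumulWeight n) :=
  monotone_nat_of_le_succ fun k => by
    rw [cumulWeight, cumulWeight, Finset.sum_range_succ]
    linarith [weight_pos n k]

lemma cumulWeight_succ (n k : ℕ) : cumulWeight n (k + 1) = cumulWeight n k + weight n k :=
  Finset.sum_range_succ _ _

lemma cumulWeight_three_mul (n k : ℕ) : cumulWeight (n + 1) (3 * k) = cumulWeight n k := by
  induction k with
  | zero => simp [cumulWeight]
  | succ k ih =>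
    rw [show 3 * (k + 1) = 3 * k + 1 + 1 + 1 by ring, cumulWeight_succ, cumulWeight_succ,
      cumulWeight_succ, ih, cumulWeight_succ, weight_three_mul, weight_three_mul_add_one,
      weight_three_mul_add_two]
    ring

lemma cumulWeight_add (n m k : ℕ) : cumulWeight (n + m) (3 ^ m * k) = cumulWeight n k := by
  induction m with
  | zero => simp
  | succ m ih => rw [← add_assoc, pow_succ', mul_assoc, cumulWeight_three_mul, ih]

/-- The distribution function of the self-similar measure with weights `2/7, 3/7, 2/7`. -/
noncomputable def cdf (t : ℝ) : ℝ := ⨆ n : ℕ, cumulWeight n ⌊3 ^ n * t⌋₊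

/-- Both sides are compared on the common refinement of level `n + m`. This makes the supremum in
`cdf` finite and locates its value within one interval of each level. -/
lemma cumulWeight_floor_le {t : ℝ} (ht : 0 ≤ t) (m n : ℕ) :
    cumulWeight m ⌊3 ^ m * t⌋₊ ≤ cumulWeight n (⌊3 ^ n * t⌋₊ + 1) := by
  rw [← cumulWeight_add m n, ← cumulWeight_add n m, add_comm n m]
  apply cumulWeight_mono
  have h1 := Nat.floor_le (show 0 ≤ (3 : ℝ) ^ m * t by positivity)
  have h2 := (Nat.lt_floor_add_one ((3 : ℝ) ^ n * t)).le
  have h3 : (3 : ℝ) ^ n * ⌊(3 : ℝ) ^ m * t⌋₊ ≤ 3 ^ m * (⌊(3 : ℝ) ^ n * t⌋₊ + 1) := by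
    calc (3 : ℝ) ^ n * ⌊(3 : ℝ) ^ m * t⌋₊ ≤ 3 ^ n * (3 ^ m * t) := by gcongr
      _ = 3 ^ m * (3 ^ n * t) := by ring
      _ ≤ _ := by gcongr
  exact_mod_cast h3

lemma cdf_le {t : ℝ} (ht : 0 ≤ t) (n : ℕ) : cdf t ≤ cumulWeight n (⌊3 ^ n * t⌋₊ + 1) :=
  ciSup_le fun m => cumulWeight_floor_le ht m n

lemma le_cdf {t : ℝ} (ht : 0 ≤ t) (n : ℕ) : cumulWeight n ⌊3 ^ n * t⌋₊ ≤ cdf t :=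
  le_ciSup (f := fun n : ℕ => cumulWeight n ⌊3 ^ n * t⌋₊)
    ⟨_, Set.forall_mem_range.2 fun m => cumulWeight_floor_le ht m 0⟩ n

/-- The distribution function applied to a coordinate. -/
noncomputable def coordCdf (j : Fin 2) (x : carpet) : ℝ := cdf (x.1 j)

lemma coordCdf_le (j : Fin 2) (x : carpet) (n : ℕ) :
    coordCdf j x ≤ cumulWeight n (gridIndex n j x + 1) := cdf_le (coord_mem x j).1 n

lemma le_coordCdf (j : Fin 2) (x : carpet) (n : ℕ) :
    cumulWeight n (gridIndex n j x) ≤ coordCdf j x := le_cdf (coord_mem x j).1 n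

/-- The two points lie in the same or in adjacent intervals, so the increment is at most one weight
plus a neighbouring one: `1 + 3/2 = 5/2`. -/
lemma abs_coordCdf_sub_le (j : Fin 2) {n : ℕ} {x y : carpet} (h : dist x y ≤ (1 / 3) ^ n) :
    |coordCdf j x - coordCdf j y| ≤ 5 / 2 * weight n (gridIndex n j x) := by
  have h1 := gridIndex_le_add_one h j
  have h2 := gridIndex_le_add_one (dist_comm x y ▸ h) j
  have hx1 := coordCdf_le j x n
  have hx2 := le_coordCdf j x n
  have hy1 := coordCdf_le j y n
  have hy2 := le_coordCdf j y n
  set k := gridIndex n j x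
  set l := gridIndex n j y
  have h3 := cumulWeight_mono n (show l + 1 ≤ k + 1 + 1 by omega)
  have h4 := (weight_neighbours n k).1
  have hp := weight_pos n k
  rw [cumulWeight_succ n (k + 1), cumulWeight_succ n k] at h3
  rw [cumulWeight_succ] at hx1
  refine abs_le.2 ⟨by linarith, ?_⟩
  rcases Nat.lt_or_ge l k with hlt | hge
  · have h5 : l + 1 = k := by omega
    have h6 := (weight_neighbours n l).2
    have h7 := cumulWeight_succ n l
    rw [h5] at h6 h7
    linarith
  · have h5 := cumulWeight_mono n hge
    linarith

lemma continuous_coordCdf (j : Fin 2) : Continuous (coordCdf j) := by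
  have hlim : Tendsto (fun n : ℕ => 5 / 2 * (3 / 7 : ℝ) ^ n) atTop (𝓝 0) := by
    simpa using (tendsto_pow_atTop_nhds_zero_of_lt_one (r := (3 / 7 : ℝ)) (by norm_num)
      (by norm_num)).const_mul (5 / 2)
  refine Metric.continuous_iff.2 fun x ε hε => ?_
  obtain ⟨n, hn⟩ := (hlim.eventually (gt_mem_nhds hε)).exists
  refine ⟨(1 / 3) ^ n, by positivity, fun y hy => lt_of_le_of_lt ?_ hn⟩
  refine (abs_coordCdf_sub_le j hy.le).trans ?_
  gcongr
  exact weight_le n _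

/-- At a fine enough level a whole triadic interval lies between the two coordinates, and every
interval has positive weight. -/
lemma coordCdf_lt {j : Fin 2} {x y : carpet} (h : x.1 j < y.1 j) : coordCdf j x < coordCdf j y := by
  obtain ⟨n, hn⟩ := pow_unbounded_of_one_lt (2 / (y.1 j - x.1 j)) (show (1 : ℝ) < 3 by norm_num)
  rw [div_lt_iff₀ (sub_pos.2 h)] at hn
  have hidx : gridIndex n j x + 1 + 1 ≤ gridIndex n j y := by
    have hx := Nat.floor_le (mul_nonneg (show (0 : ℝ) ≤ 3 ^ n by positivity) (coord_mem x j).1)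
    refine Nat.le_floor ?_
    push_cast
    unfold gridIndex
    linarith
  have h1 := coordCdf_le j x n
  have h2 := le_coordCdf j y n
  have h3 := cumulWeight_mono n hidx
  rw [cumulWeight_succ] at h3
  linarith [weight_pos n (gridIndex n j x + 1)]

/-- The crude bound `2` arises because the coordinate `1` has index `1` at level `0`. -/
lemma coordCdf_mem (j : Fin 2) (x : carpet) : coordCdf j x ∈ Set.Icc (0 : ℝ) 2 := by
  have h1 := coordCdf_le j x 0
  have h2 := le_coordCdf j x 0
  have h3 : gridIndex 0 j x ≤ 1 := by
    refine Nat.floor_le_of_le ?_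
    simpa using (coord_mem x j).2
  have h4 : (gridIndex 0 j x : ℝ) ≤ 1 := by exact_mod_cast h3
  simp only [cumulWeight, weight, Finset.sum_const, Finset.card_range, nsmul_eq_mul, mul_one] at h1 h2
  push_cast at h1
  exact ⟨le_trans (by positivity) h2, by linarith⟩

/-! ### Its energy -/

lemma IsSelfSimilar.lintegral_eq_sum {μ : Measure carpet} (hμ : IsSelfSimilar μ)
    {g : carpet → ENNReal} (hg : Measurable g) :
    8 * ∫⁻ x, g x ∂μ = ∑ i, ∫⁻ x, g (cellMap i x) ∂μ := by
  have h : (8 : ENNReal) • μ = ∑ i, μ.map (cellMap i) := by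
    ext A hA
    rw [Measure.smul_apply, smul_eq_mul, hμ.eq_sum A hA, Measure.finsetSum_apply]
    exact Finset.sum_congr rfl fun i _ => (Measure.map_apply (measurable_cellMap i) hA).symm
  rw [← smul_eq_mul, ← lintegral_smul_measure, h, lintegral_finsetSum_measure]
  exact Finset.sum_congr rfl fun i _ => lintegral_map hg (measurable_cellMap i)

lemma measurable_weight_gridIndex (n : ℕ) (j : Fin 2) :
    Measurable fun x : carpet => weight n (gridIndex n j x) :=
  (measurable_from_top (f := weight n)).comp (measurable_gridIndex n j)

/-- Six cells lie in outer columns and two in the middle one: `6 · (2/7)² + 2 · (3/7)² = 6/7`. The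
`7/6` of the lower bound originates here. -/
lemma sum_columnWeight_sq (j : Fin 2) :
    ∑ i, ENNReal.ofReal (columnWeight (digit i j) ^ 2) = ENNReal.ofReal (6 / 7) := by
  rw [← ENNReal.ofReal_sum_of_nonneg fun _ _ => sq_nonneg _]
  congr 1
  have h1 : (Finset.univ.filter fun i => digit i j = 1).card = 2 := by fin_cases j <;> decide
  have h2 : (Finset.univ.filter fun i => ¬digit i j = 1).card = 6 := by fin_cases j <;> decide
  simp only [columnWeight, ite_pow]
  rw [Finset.sum_ite, Finset.sum_const, Finset.sum_const, h1, h2]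
  norm_num

/-- By self-similarity each level multiplies the integral by `(1/8) · (6/7) = 3/28`. -/
lemma lintegral_weight_sq (n : ℕ) (j : Fin 2) :
    ∫⁻ x, ENNReal.ofReal (weight n (gridIndex n j x) ^ 2) ∂hausdorffProb =
      ENNReal.ofReal ((3 / 28) ^ n) := by
  induction n with
  | zero => simp [weight]
  | succ n ih =>
    have h8 : (8 : ENNReal) ≠ 0 := by norm_num
    refine (ENNReal.mul_right_inj h8 (by norm_num)).1 ?_
    rw [isSelfSimilar_hausdorffProb.lintegral_eq_sum
      ((measurable_weight_gridIndex (n + 1) j).pow_const 2).ennreal_ofReal]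
    have hi : ∀ i, ∫⁻ x, ENNReal.ofReal (weight (n + 1) (gridIndex (n + 1) j (cellMap i x)) ^ 2)
        ∂hausdorffProb = ENNReal.ofReal (columnWeight (digit i j) ^ 2) *
          ENNReal.ofReal ((3 / 28) ^ n) := by
      intro i
      rw [← ih, ← lintegral_const_mul' _ _ ENNReal.ofReal_ne_top]
      refine lintegral_congr_ae ?_
      filter_upwards [isSelfSimilar_hausdorffProb.ae_coord_ne] with x hx
      rw [gridIndex_cellMap, weight_add_mul n (gridIndex_lt (hx j)) (digit_le i j),
        ← ENNReal.ofReal_mul (sq_nonneg _), mul_pow, mul_comm]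
    rw [Finset.sum_congr rfl fun i _ => hi i, ← Finset.sum_mul, sum_columnWeight_sq,
      show (8 : ENNReal) = ENNReal.ofReal 8 by simp, ← ENNReal.ofReal_mul (by norm_num),
      ← ENNReal.ofReal_mul (by norm_num), pow_succ]
    congr 1
    ring

lemma measure_closedBall_le (n : ℕ) (x : carpet) :
    hausdorffProb (Metric.closedBall x ((1 / 3) ^ n)) ≤ ENNReal.ofReal (9 * (1 / 8) ^ n) := by
  have h := isSelfSimilar_hausdorffProb.measure_le_of_dist_le n x
    (Metric.closedBall x ((1 / 3) ^ n)) fun y hy => by rw [dist_comm]; exact hy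
  rw [mul_comm, ← ENNReal.le_div_iff_mul_le (by simp) (by simp)] at h
  refine h.trans_eq ?_
  rw [one_div, inv_pow, ← div_eq_mul_inv, ENNReal.ofReal_div_of_pos (by positivity),
    ENNReal.ofReal_pow (by norm_num)]
  simp

/-- Sort pairs by `3^(-n-1) < |x - y| ≤ 3⁻ⁿ`, and enlarge each annulus to a ball. The increment
bound gives `(5/2)² = 25/4`, the lower distance bound gives the exponent `n + 1`, and pairs at
distance above `1` cost at most `2² = 4`. -/
lemma ofReal_coordCdf_le {s : ℝ} (hs : 0 < s) (j : Fin 2) (x y : carpet) :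
    ENNReal.ofReal ((coordCdf j x - coordCdf j y) ^ 2 / dist x y ^ s) ≤
      ENNReal.ofReal 4 + ∑' n : ℕ, (Metric.closedBall x ((1 / 3) ^ n)).indicator
        (fun _ => ENNReal.ofReal (25 / 4 * ((3 : ℝ) ^ s) ^ (n + 1) *
          weight n (gridIndex n j x) ^ 2)) y := by
  rcases eq_or_ne x y with rfl | hne
  · simp
  have hpos : 0 < dist x y := dist_pos.2 hne
  rcases lt_or_ge 1 (dist x y) with h1 | h1
  · refine le_add_right (ENNReal.ofReal_le_ofReal ?_)
    have hx := coordCdf_mem j x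
    have hy := coordCdf_mem j y
    have hd : 1 ≤ dist x y ^ s := Real.one_le_rpow h1.le hs.le
    rw [div_le_iff₀ (by positivity)]
    nlinarith [hx.1, hx.2, hy.1, hy.2]
  · obtain ⟨n, hn1, hn2⟩ := exists_nat_pow_near_of_lt_one hpos h1 (y := (1 / 3 : ℝ)) (by norm_num)
      (by norm_num)
    refine le_add_left (le_trans ?_ (ENNReal.le_tsum n))
    rw [Set.indicator_of_mem (by rw [Metric.mem_closedBall, dist_comm]; exact hn2)]
    refine ENNReal.ofReal_le_ofReal ?_
    have h2 := abs_coordCdf_sub_le j hn2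
    have h3 : (coordCdf j x - coordCdf j y) ^ 2 ≤ (5 / 2 * weight n (gridIndex n j x)) ^ 2 :=
      sq_le_sq' (by linarith [(abs_le.1 h2).1]) (abs_le.1 h2).2
    have h4 : ((1 / 3 : ℝ) ^ (n + 1)) ^ s ≤ dist x y ^ s :=
      Real.rpow_le_rpow (by positivity) hn1.le hs.le
    have h5 : ((1 / 3 : ℝ) ^ (n + 1)) ^ s * ((3 : ℝ) ^ s) ^ (n + 1) = 1 := by
      rw [← Real.rpow_natCast ((3 : ℝ) ^ s), ← Real.rpow_mul (by norm_num), mul_comm s,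
        Real.rpow_mul (by norm_num), Real.rpow_natCast,
        ← Real.mul_rpow (by positivity) (by positivity), ← mul_pow]
      norm_num
    rw [div_le_iff₀ (by positivity)]
    calc (coordCdf j x - coordCdf j y) ^ 2 ≤ (5 / 2 * weight n (gridIndex n j x)) ^ 2 := h3
      _ = 25 / 4 * (((1 / 3 : ℝ) ^ (n + 1)) ^ s * ((3 : ℝ) ^ s) ^ (n + 1)) *
          weight n (gridIndex n j x) ^ 2 := by rw [h5]; ring
      _ = 25 / 4 * ((3 : ℝ) ^ s) ^ (n + 1) * weight n (gridIndex n j x) ^ 2 *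
          ((1 / 3 : ℝ) ^ (n + 1)) ^ s := by ring
      _ ≤ _ := by gcongr

/-- The level `n` term is a constant times `3^((α+β)n) · 8⁻ⁿ · (3/28)ⁿ = (3^β · 3/28)ⁿ`: kernel,
mass of the ball, mean squared weight. The series is geometric. -/
lemma funEnergy_coordCdf_lt_top {β : ℝ} (hβ : 0 ≤ β) (h : (3 : ℝ) ^ β < 28 / 3) (j : Fin 2) :
    funEnergy β (coordCdf j) < ⊤ := by
  set s := hausdorffDim + β with hs
  have hs0 : 0 < s := add_pos_of_pos_of_nonneg hausdorffDim_pos hβ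
  have h3s : (3 : ℝ) ^ s = 8 * 3 ^ β := by
    rw [hs, Real.rpow_add (by norm_num), three_rpow_hausdorffDim]
  -- Here `225/4 = 9 · 25/4`, the `9` coming from the mass of a ball.
  set K : ℕ → ℝ := fun n => 225 / 4 * (3 : ℝ) ^ s * ((3 : ℝ) ^ β) ^ n with hK
  have hK0 : ∀ n, 0 ≤ K n := fun n => by positivity
  have hinner : ∀ x, ∫⁻ y, ENNReal.ofReal ((coordCdf j x - coordCdf j y) ^ 2 / dist x y ^ s)
      ∂hausdorffProb ≤ ENNReal.ofReal 4 + ∑' n : ℕ, ENNReal.ofReal (K n) *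
        ENNReal.ofReal (weight n (gridIndex n j x) ^ 2) := by
    intro x
    refine (lintegral_mono fun y => ofReal_coordCdf_le hs0 j x y).trans ?_
    rw [lintegral_add_left measurable_const, lintegral_const, measure_univ, mul_one, lintegral_tsum
      fun n => (measurable_const.indicator Metric.isClosed_closedBall.measurableSet).aemeasurable]
    gcongr with n
    rw [lintegral_indicator_const Metric.isClosed_closedBall.measurableSet]
    refine (mul_le_mul_right (measure_closedBall_le n x) _).trans_eq ?_
    rw [← ENNReal.ofReal_mul (by positivity), ← ENNReal.ofReal_mul (hK0 n)]
    congr 1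
    have h8 : ((3 : ℝ) ^ s) ^ (n + 1) * (1 / 8) ^ n = (3 : ℝ) ^ s * ((3 : ℝ) ^ β) ^ n := by
      rw [pow_succ, h3s, mul_right_comm, ← mul_pow, mul_comm]
      congr 2
      ring
    calc _ = 225 / 4 * (((3 : ℝ) ^ s) ^ (n + 1) * (1 / 8) ^ n) *
          weight n (gridIndex n j x) ^ 2 := by ring
      _ = _ := by rw [h8, hK]; ring
  have hmeas : ∀ n, Measurable fun x : carpet =>
      ENNReal.ofReal (weight n (gridIndex n j x) ^ 2) := fun n =>
    ((measurable_weight_gridIndex n j).pow_const 2).ennreal_ofReal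
  have hsum : Summable fun n => K n * (3 / 28) ^ n := by
    have hq : (3 : ℝ) ^ β * (3 / 28) < 1 := by linarith
    have := (summable_geometric_of_lt_one (by positivity) hq).mul_left (225 / 4 * (3 : ℝ) ^ s)
    refine this.congr fun n => ?_
    rw [hK, mul_pow]
    ring
  refine (lintegral_mono hinner).trans_lt ?_
  rw [lintegral_add_left measurable_const, lintegral_const, measure_univ, mul_one,
    lintegral_tsum fun n => ((hmeas n).const_mul _).aemeasurable]
  simp only [lintegral_const_mul' _ _ ENNReal.ofReal_ne_top, lintegral_weight_sq]
  simp only [← ENNReal.ofReal_mul (hK0 _)]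
  exact ENNReal.add_lt_top.2 ⟨ENNReal.ofReal_lt_top, hsum.tsum_ofReal_lt_top⟩

/-! ### The lower bound -/

/-- The algebra of continuous functions of finite energy. -/
noncomputable def energyAlgebra (β : ℝ) : Subalgebra ℝ C(carpet, ℝ) where
  carrier := {f | MemLp (diffQuot β f) 2 prodMeasure}
  algebraMap_mem' c := by
    have h : diffQuot β (algebraMap ℝ C(carpet, ℝ) c) = 0 := by
      ext p
      simp [diffQuot]
    rw [Set.mem_ofPred_eq, h]
    exact MemLp.zero
  add_mem' {f g} hf hg := by
    have h : diffQuot β (f + g : C(carpet, ℝ)) = diffQuot β f + diffQuot β g := by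
      ext p
      simp only [diffQuot, ContinuousMap.add_apply, Pi.add_apply]
      ring
    rw [Set.mem_ofPred_eq, h]
    exact hf.add hg
  mul_mem' {f g} hf hg := by
    -- Leibniz rule for differences; each summand is a bounded function times a square integrable
    -- one.
    have h : diffQuot β (f * g : C(carpet, ℝ)) =
        (fun p => f p.1 * diffQuot β g p) + fun p => g p.2 * diffQuot β f p := by
      ext p
      simp only [diffQuot, ContinuousMap.mul_apply, Pi.add_apply]
      ring
    rw [Set.mem_ofPred_eq, h]
    refine MemLp.add (hg.of_le_mul (c := ‖f‖) ?_ ?_) (hf.of_le_mul (c := ‖g‖) ?_ ?_)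
    · exact (f.continuous.comp continuous_fst).aestronglyMeasurable.mul hg.1
    · refine Eventually.of_forall fun p => ?_
      rw [norm_mul]
      gcongr
      exact f.norm_coe_le_norm _
    · exact (g.continuous.comp continuous_snd).aestronglyMeasurable.mul hf.1
    · refine Eventually.of_forall fun p => ?_
      rw [norm_mul]
      gcongr
      exact g.norm_coe_le_norm _

lemma mem_energyAlgebra_iff {β : ℝ} {f : C(carpet, ℝ)} :
    f ∈ energyAlgebra β ↔ funEnergy β f < ⊤ :=
  memLp_diffQuot_iff f.continuous.aestronglyMeasurable

lemma separatesPoints_energyAlgebra {β : ℝ} (hβ : 0 ≤ β) (h : (3 : ℝ) ^ β < 28 / 3) :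
    (energyAlgebra β).SeparatesPoints := by
  intro x y hxy
  obtain ⟨j, hj⟩ : ∃ j, x.1 j ≠ y.1 j := by
    by_contra! hcon
    exact hxy (Subtype.ext (PiLp.ext hcon))
  refine ⟨coordCdf j, ⟨⟨coordCdf j, continuous_coordCdf j⟩,
    mem_energyAlgebra_iff.2 (funEnergy_coordCdf_lt_top hβ h j), rfl⟩, ?_⟩
  rcases hj.lt_or_gt with hlt | hlt
  · exact (coordCdf_lt hlt).ne
  · exact (coordCdf_lt hlt).ne'

lemma mem_regularIndices {β : ℝ} (hβ : hausdorffDim < β)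
    (hβ' : β < Real.log (8 * (7 / 6)) / Real.log 3) : β ∈ regularIndices := by
  have hpos : 0 < β := hausdorffDim_pos.trans hβ
  have h3 : (3 : ℝ) ^ β < 28 / 3 := by
    rw [lt_div_iff₀ (Real.log_pos (by norm_num)), ← Real.log_rpow (by norm_num),
      Real.log_lt_log_iff (by positivity) (by norm_num)] at hβ'
    linarith
  refine ⟨hpos, isRegularDirichletForm_of (fun u hu => exists_continuous_ae_eq hβ hu)
    fun g hg ε hε => ?_⟩
  obtain ⟨⟨f, hf⟩, hgf⟩ := ContinuousMap.exists_mem_subalgebra_near_continuous_of_separatesPoints _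
    (separatesPoints_energyAlgebra hpos.le h3) g hg ε hε
  have hcoe := ContinuousMap.coeFn_toLp (p := 2) (𝕜 := ℝ) hausdorffProb f
  refine ⟨ContinuousMap.toLp 2 hausdorffProb ℝ f, ?_, f, f.continuous, hcoe, fun x => ?_⟩
  · exact (funEnergy_congr hcoe).trans_lt (mem_energyAlgebra_iff.1 hf)
  · rw [abs_sub_comm]
    exact hgf x

/-- Because `7/6 > 1`, there are exponents with both continuity and enough finite-energy functions.
-/
lemma hausdorffDim_lt : hausdorffDim < Real.log (8 * (7 / 6)) / Real.log 3 :=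
  div_lt_div_of_pos_right (Real.log_lt_log (by norm_num) (by norm_num)) (Real.log_pos (by norm_num))

end SierpinskiCarpet

/-- Bounds for the walk dimension of the Sierpiński carpet. The first two conjuncts say that the
supremum defining the walk dimension is a genuine one (of a nonempty set that is bounded above). -/
theorem theorem1p4 :
    SierpinskiCarpet.regularIndices.Nonempty ∧
    BddAbove SierpinskiCarpet.regularIndices ∧
    SierpinskiCarpet.walkDim ∈
      Set.Icc (Real.log (8 * (7 / 6)) / Real.log 3) (Real.log (8 * (3 / 2)) / Real.log 3) := by
  open SierpinskiCarpet in
  have hne : regularIndices.Nonempty :=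
    (exists_between hausdorffDim_lt).imp fun _ h => mem_regularIndices h.1 h.2
  have hbdd : BddAbove regularIndices := ⟨_, fun _ => le_of_mem_regularIndices⟩
  refine ⟨hne, hbdd, le_of_forall_lt fun c hc => ?_, csSup_le hne fun _ => le_of_mem_regularIndices⟩
  -- Regularity is established only for `β > α`, so the exponent is chosen above `α` as well as
  -- above `c`.
  obtain ⟨β, h1, h2⟩ := exists_between (max_lt hc hausdorffDim_lt)
  exact (lt_of_le_of_lt (le_max_left _ _) h1).trans_le
    (le_csSup hbdd (mem_regularIndices (lt_of_le_of_lt (le_max_right _ _) h1) h2))
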